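/- All asymptotics are as $n\to\infty$. For ${\bf d}=(d_1,\dots,d_n)\in\mathbb{Z}_{\ge 0}^n$ write $\|{\bf d}\|_1=\sum_{i} d_i$, $\Delta({\bf d})=\max_i d_i$, $\delta({\bf d})=\min_i d_i$, and let $P({\bf d})$ be the symmetric $n\times n$ matrix with $P({\bf d})_{jk}=\dfrac{d_jd_k}{\|{\bf d}\|_1+d_jd_k}$ for $j\ne k$ and $P({\bf d})_{jj}=0$. If $\|{\bf d}\|_1$ is even, $\mathcal G(n,{\bf d})$ denotes a uniformly random simple graph on $[n]$ in which each vertex $i$ has degree $d_i$. For a symmetric matrix $W\in[0,1]^{n\times n}$, $\mathcal G(n,W)$ denotes the random graph on $[n]$ in which each pair $jk$ with $j\neq k$ is an edge with probability $W_{jk}$, independently of the other pairs. **Theorem.** For each $n$ let ${\bf d}={\bf d}(n)\in\mathbb{Z}_{\ge0}^n$ be a sequence with $\|{\bf d}\|_1$ even, and suppose that $$\Delta({\bf d})^2=o(\|{\bf d}\|_1)\qquad\text{and}\qquad \log n=o(\delta({\bf d})).$$ Then there are symmetric matrices $W=W(n)\in[0,1]^{n\times n}$ (for all sufficiently large $n$)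 with $W=(1-o(1))P({\bf d})$, that is, for some $\varepsilon_n\to0$, $$(1-\varepsilon_n)P({\bf d})_{jk}\le W_{jk}\le P({\bf d})_{jk}\qquad\text{for all } j,k\in[n],$$ and a coupling $(G_L,G)$ (two random graphs on a common probability space) with $G_L\sim\mathcal G(n,W)$ and $G\sim\mathcal G(n,{\bf d})$, such that $$\mathbb P(G_L\subseteq G)=1-o(1).$$ In particular, graphs with degree sequence ${\bf d}(n)$ exist for all sufficiently large $n$. Moreover this embedding is optimal in the sense that $P({\bf d})$ is asymptotic to the matrix of true edge probabilities: for some $\eta_n\to0$ and all sufficiently large $n$, $$\bigl|\mathbb P(jk\in\mathcal G(n,{\bf d}))-P({\bf d})_{jk}\bigr|\le\eta_n\,P({\bf d})_{jk}\qquad\text{for all } j\ne k.$$ -/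

import Mathlib

open MeasureTheory Filter Topology

namespace RandomGraphEmbedding

variable {n : ℕ}

/-- The `ℓ¹`-norm `‖d‖₁ = d₁ + ⋯ + dₙ` of a sequence of natural numbers. -/
def total (d : Fin n → ℕ) : ℕ := ∑ i, d i

/-- The maximum degree `Δ(d)`. -/
def maxDeg (d : Fin n → ℕ) : ℕ := Finset.univ.sup d

/-- The minimum degree `δ(d)` (with the value `0` when `n = 0`). -/
noncomputable def minDeg (d : Fin n → ℕ) : ℕ := ⨅ i, d i

/-- The symmetric matrix `P(d)`, with `P(d)ⱼₖ = dⱼ dₖ / (‖d‖₁ + dⱼ dₖ)` for `j ≠ k` and zeros on the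
diagonal. -/
noncomputable def edgeMatrix (d : Fin n → ℕ) : Matrix (Fin n) (Fin n) ℝ :=
  Matrix.of fun j k =>
    if j = k then 0 else (d j * d k : ℝ) / ((total d : ℝ) + d j * d k)

open Classical in
/-- The probability that the random graph on `Fin n` in which every pair `j < k` is an edge
independently with probability `W j k` equals the graph `G`. -/
noncomputable def inhomogeneousWeight (W : Matrix (Fin n) (Fin n) ℝ)
    (G : SimpleGraph (Fin n)) : ℝ :=
  ∏ j : Fin n, ∏ k ∈ Finset.Ioi j, if G.Adj j k then W j k else 1 - W j k

/-- The law of `𝒢(n, W)`, for a symmetric matrix `W` with entries in `[0, 1]`: each pair `jk` is an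
edge with probability `W j k`, independently of the other pairs. -/
noncomputable def inhomogeneousGraph (W : Matrix (Fin n) (Fin n) ℝ) :
    Measure (SimpleGraph (Fin n)) :=
  Measure.sum fun G => ENNReal.ofReal (inhomogeneousWeight W G) • Measure.dirac G

/-- The graphs on `Fin n` in which each vertex `i` has degree `d i`. -/
def graphsWithDegrees (d : Fin n → ℕ) : Set (SimpleGraph (Fin n)) :=
  {G | ∀ i, (G.neighborSet i).ncard = d i}

/-- The law of `𝒢(n, d)`: the uniform probability measure on the graphs with degree sequence `d`
(it is the zero measure if there is no such graph). -/
noncomputable def degreeGraph (d : Fin n → ℕ) : Measure (SimpleGraph (Fin n)) :=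
  ProbabilityTheory.uniformOn (graphsWithDegrees d)

/-- `μ` is (the joint law of) a coupling of `ν₁` and `ν₂`: on the probability space `(α × β, μ)` the
two coordinates have laws `ν₁` and `ν₂`. -/
structure IsCoupling {α β : Type*} [MeasurableSpace α] [MeasurableSpace β]
    (μ : Measure (α × β)) (ν₁ : Measure α) (ν₂ : Measure β) : Prop where
  isProbabilityMeasure : IsProbabilityMeasure μ
  map_fst : μ.map Prod.fst = ν₁
  map_snd : μ.map Prod.snd = ν₂

end RandomGraphEmbedding

/-! Write M for the degree sum and give the edges of a uniform graph `G` with degrees `d`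
independent uniform arrival times in [0, 1]. The edges arrived by time t form a thinning `H` of `G`.
All such graphs have the same number of edges, so given `H` the graph `G` is uniform on the members
of the family that contain `H`, and an absent pair e arrives at rate P(e ∈ G | H) / (1 - t).

By Chernoff bounds (`sum_productWeight_not_hasFraction_le`), which suffice because log n = o(δ),
with high probability `H` has about t * d v edges at every v. For such `H`, switchings show that jk
is still to come with probability at least (1 - t)(1 - γ) d_j d_k / M
(`IsModerate.mul_extCount_le_extCount_insert`), because Δ² = o(M). So up to time 1 - γ every absent
edge arrives at least as fast as in independent Poisson processes of rates θ = (1 - γ) d_j d_k / M.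

The comparison is made by interpolation (`sum_productWeight_mul_le`): for monotone f, the
expectation of f(H_t ∪ R_t), with R_t the Poisson arrivals between t and τ, is nondecreasing in t up
to the contribution of atypical `H`. Hence the independent graph is almost stochastically dominated
by `G`, and an approximate Strassen theorem (`exists_coupling_of_upperSet_le`) turns this into a
coupling. Its edge probabilities 1 - exp(-θ(1 - γ)) lie just below P(d).

The same switching estimates with `H` empty give the true edge probabilities. Everything is proved
for fixed γ; finally γ tends to 0 slowly with n. -/

namespace RandomGraphEmbedding

/-! ### Approximate Strassen theorem on a finite preorder. -/

section Strassen

variable {X : Type*} [Fintype X] [Preorder X]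

/-- The nonnegative matrices with row sums `μ` that only move mass upwards. -/
def upwardPlans (μ : X → ℝ) : Set (X → X → ℝ) :=
  {π | (∀ x y, 0 ≤ π x y) ∧ (∀ x, ∑ y, π x y = μ x) ∧ ∀ x y, ¬ x ≤ y → π x y = 0}

theorem isCompact_upwardPlans (μ : X → ℝ) : IsCompact (upwardPlans μ) := by
  have hsub : upwardPlans μ ⊆ Set.Icc 0 (fun x _ => μ x) := by
    rintro π ⟨h0, h1, -⟩
    refine ⟨fun x y => h0 x y, fun x y => ?_⟩
    change π x y ≤ μ x
    rw [← h1 x]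
    exact Finset.single_le_sum (f := fun y => π x y) (fun y _ => h0 x y) (Finset.mem_univ y)
  refine IsCompact.of_isClosed_subset isCompact_Icc ?_ hsub
  have : upwardPlans μ = (⋂ x, ⋂ y, {π : X → X → ℝ | 0 ≤ π x y}) ∩
      ((⋂ x, {π : X → X → ℝ | ∑ y, π x y = μ x}) ∩
        ⋂ x, ⋂ y, ⋂ (_ : ¬ x ≤ y), {π : X → X → ℝ | π x y = 0}) := by
    ext π
    simp [upwardPlans]
  rw [this]
  refine IsClosed.inter ?_ (IsClosed.inter ?_ ?_)
  · exact isClosed_iInter fun x => isClosed_iInter fun y =>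
      isClosed_le continuous_const (by fun_prop)
  · exact isClosed_iInter fun x => isClosed_eq (by fun_prop) continuous_const
  · exact isClosed_iInter fun x => isClosed_iInter fun y => isClosed_iInter fun _ =>
      isClosed_eq (by fun_prop) continuous_const

/-- There is an upward plan whose column sums cannot be balanced further: mass sits at `y` only if
every other admissible target carries at least the same excess over `ν`. -/
theorem exists_balanced_upwardPlan {μ : X → ℝ} (hμ : ∀ x, 0 ≤ μ x) (ν : X → ℝ) :
    ∃ π ∈ upwardPlans μ, ∀ x y y', 0 < π x y → x ≤ y' →
      (∑ z, π z y) - ν y ≤ (∑ z, π z y') - ν y' := by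
  classical
  have hne : (upwardPlans μ).Nonempty := by
    refine ⟨fun x y => if y = x then μ x else 0, fun x y => ?_, fun x => by simp, ?_⟩
    · dsimp only; split_ifs
      exacts [hμ x, le_rfl]
    · intro x y h
      dsimp only
      rw [if_neg]
      rintro rfl
      exact h le_rfl
  -- The plan minimises the squared distance of its column sums from `ν`; shifting mass from a
  -- larger excess to a smaller one would lower it.
  obtain ⟨π, hπ, hmin⟩ := (isCompact_upwardPlans μ).exists_isMinOn hne
    (f := fun π : X → X → ℝ => ∑ y, ((∑ z, π z y) - ν y) ^ 2) (by fun_prop)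
  refine ⟨π, hπ, fun x y y' hxy hle => ?_⟩
  by_contra! hlt
  have hyy : y ≠ y' := by rintro rfl; exact lt_irrefl _ hlt
  set e : X → ℝ := fun y => (∑ z, π z y) - ν y with he
  change e y' < e y at hlt
  -- A shift by `s` changes the objective by 2s² - 2s(e y - e y'), which is negative for 0 < s ≤ (e
  -- y - e y') / 2; the bound by `π x y` keeps the plan nonnegative.
  set s : ℝ := min (π x y) ((e y - e y') / 2) with hs
  have hs0 : 0 < s := lt_min hxy (by linarith)
  have hs1 : s ≤ π x y := min_le_left _ _
  have hs2 : s ≤ (e y - e y') / 2 := min_le_right _ _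
  let δ : X → X → ℝ := fun a b =>
    (if a = x ∧ b = y' then s else 0) - (if a = x ∧ b = y then s else 0)
  have hmem : (fun a b => π a b + δ a b) ∈ upwardPlans μ := by
    refine ⟨fun a b => ?_, fun a => ?_, fun a b hab => ?_⟩
    · have := hπ.1 a b
      simp only [δ]
      split_ifs with h1 h2 h2
      · linarith
      · linarith
      · rw [h2.1, h2.2]; linarith
      · linarith
    · rw [Finset.sum_add_distrib, hπ.2.1 a, Finset.sum_sub_distrib]
      by_cases ha : a = x <;> simp [ha]
    · have h3 := hπ.2.2 a b hab
      have h1 : ¬ (a = x ∧ b = y') := by rintro ⟨rfl, rfl⟩; exact hab hle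
      have h2 : ¬ (a = x ∧ b = y) := by rintro ⟨rfl, rfl⟩; linarith
      simp [δ, h1, h2, h3]
  have hcol : ∀ b, (∑ z, (π z b + δ z b)) - ν b =
      e b + ((if b = y' then s else 0) - if b = y then s else 0) := by
    intro b
    have : ∑ z, δ z b = (if b = y' then s else 0) - if b = y then s else 0 := by
      simp only [δ, Finset.sum_sub_distrib]
      congr 1
      · by_cases hb : b = y' <;> simp [hb]
      · by_cases hb : b = y <;> simp [hb]
    rw [Finset.sum_add_distrib, this, he]; ring
  have hkey := hmin hmem
  simp only [Set.mem_ofPred_eq, hcol] at hkey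
  have hdiff : ∑ b, ((e b + ((if b = y' then s else 0) - if b = y then s else 0)) ^ 2 - e b ^ 2)
      = 2 * s * (e y' - e y) + 2 * s ^ 2 := by
    have : ∀ b, ((e b + ((if b = y' then s else 0) - if b = y then s else 0)) ^ 2 - e b ^ 2)
        = (if b = y' then 2 * s * e b + s ^ 2 else 0) +
          (if b = y then - (2 * s * e b) + s ^ 2 else 0) := by
      intro b
      by_cases h1 : b = y'
      · have h2 : b ≠ y := by rintro rfl; exact hyy h1
        simp only [h1, if_true, if_neg (h1 ▸ h2)]; ring
      · by_cases h2 : b = y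
        · simp only [h2, if_true, if_neg hyy]; ring
        · simp [h1, h2]
    simp only [this, Finset.sum_add_distrib, Finset.sum_ite_eq', Finset.mem_univ, if_true]
    ring
  rw [Finset.sum_sub_distrib] at hdiff
  have hkey' : ∑ b, e b ^ 2 ≤
      ∑ b, (e b + ((if b = y' then s else 0) - if b = y then s else 0)) ^ 2 := hkey
  nlinarith

/-- An approximate form of Strassen's theorem on a finite preorder. -/
theorem exists_coupling_of_upperSet_le {μ ν : X → ℝ} (hμ : ∀ x, 0 ≤ μ x) (hν : ∀ x, 0 ≤ ν x)
    (hμ1 : ∑ x, μ x = 1) (hν1 : ∑ x, ν x = 1) {ε : ℝ}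
    (h : ∀ U : Finset X, IsUpperSet (U : Set X) → ∑ x ∈ U, μ x ≤ ∑ x ∈ U, ν x + ε) :
    ∃ J : X → X → ℝ, (∀ x y, 0 ≤ J x y) ∧ (∀ x, ∑ y, J x y = μ x) ∧ (∀ y, ∑ x, J x y = ν y) ∧
      ∀ s : Finset (X × X), (∀ x y, x ≤ y → (x, y) ∈ s) → 1 - ε ≤ ∑ p ∈ s, J p.1 p.2 := by
  classical
  obtain ⟨π, ⟨hπ0, hπr, hπs⟩, hbal⟩ := exists_balanced_upwardPlan hμ ν
  set ρ : X → ℝ := fun y => ∑ z, π z y with hρ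
  have hρ0 : ∀ y, 0 ≤ ρ y := fun y => Finset.sum_nonneg fun z _ => hπ0 z y
  have hρ1 : ∑ y, ρ y = 1 := by
    rw [hρ, Finset.sum_comm]; simp [hπr, hμ1]
  -- total excess
  have hexc : ∑ y, max (ρ y - ν y) 0 ≤ ε := by
    let V : Finset X := Finset.univ.filter fun y => 0 < ρ y - ν y
    let S : Finset X := Finset.univ.filter fun x => ∃ y ∈ V, 0 < π x y
    -- Balance forces every target above a source in `S` to have positive excess, so `U ⊆ V`. All
    -- mass landing in `V` starts in `S ⊆ U`, so the total excess is at most μ(U) - ν(U) ≤ ε.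
    let U : Finset X := Finset.univ.filter fun y => ∃ x ∈ S, x ≤ y
    have hSU : S ⊆ U := fun x hx => by
      simp only [U, Finset.mem_filter, Finset.mem_univ, true_and]; exact ⟨x, hx, le_rfl⟩
    have hUV : U ⊆ V := by
      intro y' hy'
      simp only [U, Finset.mem_filter, Finset.mem_univ, true_and] at hy'
      obtain ⟨x, hx, hxy'⟩ := hy'
      simp only [S, Finset.mem_filter, Finset.mem_univ, true_and] at hx
      obtain ⟨y, hy, hxy⟩ := hx
      simp only [V, Finset.mem_filter, Finset.mem_univ, true_and] at hy ⊢
      exact hy.trans_le (hbal x y y' hxy hxy')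
    have hU : IsUpperSet (U : Set X) := by
      intro a b hab ha
      simp only [U, Finset.coe_filter, Finset.mem_univ, true_and, Set.mem_ofPred_eq] at ha ⊢
      obtain ⟨x, hx, hxa⟩ := ha
      exact ⟨x, hx, hxa.trans hab⟩
    have h1 : ∑ y ∈ V, ρ y ≤ ∑ x ∈ S, μ x := by
      rw [hρ, Finset.sum_comm, ← Finset.sum_subset (Finset.subset_univ S)]
      · refine Finset.sum_le_sum fun x _ => ?_
        rw [← hπr x]
        exact Finset.sum_le_sum_of_subset_of_nonneg (Finset.subset_univ _) fun y _ _ => hπ0 x y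
      · intro x _ hx
        refine Finset.sum_eq_zero fun y hy => ?_
        by_contra hne
        refine hx ?_
        simp only [S, Finset.mem_filter, Finset.mem_univ, true_and]
        exact ⟨y, hy, lt_of_le_of_ne (hπ0 x y) (Ne.symm hne)⟩
    have h2 : ∑ x ∈ S, μ x ≤ ∑ x ∈ U, μ x :=
      Finset.sum_le_sum_of_subset_of_nonneg hSU fun x _ _ => hμ x
    have h3 : ∑ x ∈ U, ν x ≤ ∑ x ∈ V, ν x :=
      Finset.sum_le_sum_of_subset_of_nonneg hUV fun x _ _ => hν x
    have h4 : ∑ y, max (ρ y - ν y) 0 = ∑ y ∈ V, (ρ y - ν y) := by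
      rw [Finset.sum_filter]
      refine Finset.sum_congr rfl fun y _ => ?_
      split_ifs with hy
      · exact max_eq_left hy.le
      · exact max_eq_right (not_lt.mp hy)
    rw [h4, Finset.sum_sub_distrib]
    linarith [h U hU]
  set D : ℝ := ∑ y, max (ρ y - ν y) 0 with hD
  have hD' : ∑ y, max (ν y - ρ y) 0 = D := by
    have : ∑ y, (max (ρ y - ν y) 0 - max (ν y - ρ y) 0) = 0 := by
      have h5 : ∀ y, max (ρ y - ν y) 0 - max (ν y - ρ y) 0 = ρ y - ν y := by
        intro y
        rcases le_total (ρ y) (ν y) with h | h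
        · rw [max_eq_right (by linarith), max_eq_left (by linarith)]; ring
        · rw [max_eq_left (by linarith), max_eq_right (by linarith)]; ring
      simp only [h5, Finset.sum_sub_distrib, hρ1, hν1, sub_self]
    rw [Finset.sum_sub_distrib] at this
    linarith
  have hD0 : 0 ≤ D := Finset.sum_nonneg fun y _ => le_max_right _ _
  -- the fraction of the mass at `y` that stays
  let r : X → ℝ := fun y => if ρ y ≤ ν y then 1 else ν y / ρ y
  have hr : ∀ y, 0 ≤ r y ∧ r y ≤ 1 ∧ ρ y * (1 - r y) = max (ρ y - ν y) 0 := by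
    intro y
    simp only [r]
    split_ifs with hy
    · exact ⟨zero_le_one, le_rfl, by rw [max_eq_right (by linarith)]; ring⟩
    · push Not at hy
      have hpos : 0 < ρ y := (hν y).trans_lt hy
      refine ⟨div_nonneg (hν y) hpos.le, (div_le_one hpos).2 hy.le, ?_⟩
      rw [max_eq_left (by linarith)]
      field_simp
  let loss : X → ℝ := fun x => ∑ y, π x y * (1 - r y)
  have hloss0 : ∀ x, 0 ≤ loss x := fun x => Finset.sum_nonneg fun y _ =>
    mul_nonneg (hπ0 x y) (by linarith [(hr y).2.1])
  have hlossD : ∑ x, loss x = D := by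
    simp only [loss]
    rw [Finset.sum_comm]
    simp only [← Finset.sum_mul]
    exact Finset.sum_congr rfl fun y _ => (hr y).2.2
  -- The excess is taken away and spread over the deficits in proportion, ignoring the order; only
  -- this part, of mass `D`, can violate x ≤ y. If `D = 0` the division is harmless because every
  -- loss vanishes.
  refine ⟨fun x y => π x y * r y + loss x * (max (ν y - ρ y) 0 / D), fun x y => ?_, fun x => ?_,
    fun y => ?_, fun s hs => ?_⟩
  · exact add_nonneg (mul_nonneg (hπ0 x y) (hr y).1)
      (mul_nonneg (hloss0 x) (div_nonneg (le_max_right _ _) hD0))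
  · rw [Finset.sum_add_distrib, ← Finset.mul_sum, ← Finset.sum_div, hD']
    have h6 : loss x * (D / D) = loss x := by
      rcases eq_or_ne D 0 with h0 | h0
      · have : loss x = 0 := by
          have := (Finset.sum_eq_zero_iff_of_nonneg (fun x _ => hloss0 x)).1 (hlossD.trans h0)
          exact this x (Finset.mem_univ x)
        simp [this]
      · rw [div_self h0, mul_one]
    rw [h6, ← Finset.sum_add_distrib, ← hπr x]
    exact Finset.sum_congr rfl fun y _ => by ring
  · rw [Finset.sum_add_distrib, ← Finset.sum_mul, ← Finset.sum_mul, hlossD]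
    change ρ y * r y + _ = _
    have h7 : D * (max (ν y - ρ y) 0 / D) = max (ν y - ρ y) 0 := by
      rcases eq_or_ne D 0 with h0 | h0
      · have := (Finset.sum_eq_zero_iff_of_nonneg
          (fun y _ => le_max_right (ν y - ρ y) 0)).1 (hD'.trans h0)
        rw [this y (Finset.mem_univ y)]; simp
      · field_simp
    rw [h7]
    have h8 := (hr y).2.2
    rcases le_total (ρ y) (ν y) with h | h
    · rw [max_eq_right (by linarith)] at h8
      rw [max_eq_left (by linarith)]; linarith
    · rw [max_eq_left (by linarith)] at h8
      rw [max_eq_right (by linarith)]; linarith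
  · have h9 : ∑ p ∈ s, π p.1 p.2 * r p.2 = ∑ p : X × X, π p.1 p.2 * r p.2 := by
      refine Finset.sum_subset (Finset.subset_univ s) fun p _ hp => ?_
      rw [hπs p.1 p.2 fun hle => hp (hs p.1 p.2 hle), zero_mul]
    have h10 : ∑ p : X × X, π p.1 p.2 * r p.2 = 1 - D := by
      rw [Fintype.sum_prod_type, ← hlossD, ← hμ1, ← Finset.sum_sub_distrib]
      refine Finset.sum_congr rfl fun x _ => ?_
      rw [← hπr x, ← Finset.sum_sub_distrib]
      exact Finset.sum_congr rfl fun y _ => by ring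
    calc 1 - ε ≤ 1 - D := by linarith
      _ = ∑ p ∈ s, π p.1 p.2 * r p.2 := by rw [h9, h10]
      _ ≤ _ := Finset.sum_le_sum fun p _ => le_add_of_nonneg_right
          (mul_nonneg (hloss0 _) (div_nonneg (le_max_right _ _) hD0))

end Strassen

/-! ### Interpolation between a thinned random member of a family and an independent random set. -/

section Interpolation

variable {α : Type*} [DecidableEq α]

/-- The retention probabilities of the `t`-thinning of `G`. -/
def thinning (t : ℝ) (G : Finset α) (e : α) : ℝ := if e ∈ G then t else 0

theorem thinning_nonneg {t : ℝ} (ht : 0 ≤ t) (G : Finset α) (e : α) : 0 ≤ thinning t G e := by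
  unfold thinning; split_ifs <;> simp [ht]

theorem thinning_le_one {t : ℝ} (ht : t ≤ 1) (G : Finset α) (e : α) : thinning t G e ≤ 1 := by
  unfold thinning; split_ifs <;> simp [ht]

variable [Fintype α]

/-- The probability that the random subset containing each `e` independently with probability
`p e` equals `R`. -/
def productWeight (p : α → ℝ) (R : Finset α) : ℝ :=
  ∏ e, if e ∈ R then p e else 1 - p e

/-- `productWeight` with the factor of `e` left out. -/
def productWeightErase (p : α → ℝ) (e : α) (R : Finset α) : ℝ :=
  ∏ a ∈ Finset.univ.erase e, if a ∈ R then p a else 1 - p a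

theorem productWeight_nonneg {p : α → ℝ} (h0 : ∀ e, 0 ≤ p e) (h1 : ∀ e, p e ≤ 1) (R : Finset α) :
    0 ≤ productWeight p R := by
  refine Finset.prod_nonneg fun e _ => ?_
  split_ifs
  exacts [h0 e, sub_nonneg.2 (h1 e)]

/-- The generating function of a product measure: `x = 1` gives the normalisation, exponential `x`
the Chernoff bound. -/
theorem sum_productWeight_mul_prod (p x : α → ℝ) :
    ∑ R, productWeight p R * ∏ e ∈ R, x e = ∏ e, (p e * x e + (1 - p e)) := by
  rw [Fintype.prod_add]
  refine Finset.sum_congr rfl fun R _ => ?_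
  rw [productWeight, Finset.prod_ite, Finset.filter_mem_eq_inter, Finset.univ_inter,
    Finset.prod_mul_distrib]
  have : Finset.univ.filter (fun e => e ∉ R) = Rᶜ := by ext; simp
  rw [this]; ring

theorem sum_productWeight (p : α → ℝ) : ∑ R, productWeight p R = 1 := by
  have := sum_productWeight_mul_prod p fun _ => 1
  simpa using this

theorem productWeight_eq_zero {p : α → ℝ} {R : Finset α} {e : α} (he : e ∈ R) (h : p e = 0) :
    productWeight p R = 0 :=
  Finset.prod_eq_zero (Finset.mem_univ e) (by simp [he, h])

theorem productWeight_eq_mul_erase (p : α → ℝ) (e : α) (R : Finset α) :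
    productWeight p R = (if e ∈ R then p e else 1 - p e) * productWeightErase p e R :=
  (Finset.mul_prod_erase Finset.univ (fun a => if a ∈ R then p a else 1 - p a)
    (Finset.mem_univ e)).symm

theorem productWeightErase_insert (p : α → ℝ) (e : α) (R : Finset α) :
    productWeightErase p e (insert e R) = productWeightErase p e R := by
  refine Finset.prod_congr rfl fun a ha => ?_
  simp [Finset.ne_of_mem_erase ha]

theorem sum_eq_sum_filter_notMem_add (e : α) (F : Finset α → ℝ) :
    ∑ R, F R = ∑ R ∈ Finset.univ.filter (fun R => e ∉ R), (F R + F (insert e R)) := by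
  rw [Finset.sum_add_distrib, ← Finset.sum_filter_add_sum_filter_not Finset.univ (fun R => e ∉ R)]
  congr 1
  refine (Finset.sum_bij' (fun R _ => insert e R) (fun R _ => R.erase e) ?_ ?_ ?_ ?_ ?_).symm
  · simp
  · simp
  · intro R hR
    simp only [Finset.mem_filter, Finset.mem_univ, true_and] at hR
    exact Finset.erase_insert hR
  · intro R hR
    simp only [Finset.mem_filter, Finset.mem_univ, true_and, not_not] at hR
    exact Finset.insert_erase hR
  · simp

/-- The derivative of `productWeight p R` when each `p e` has derivative `c e * (1 - p e)`. -/
def productWeightDeriv (p c : α → ℝ) (R : Finset α) : ℝ :=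
  ∑ e, productWeightErase p e R *
    if e ∈ R then c e * (1 - p e) else -(c e * (1 - p e))

/-- Writing the derivative as `c e * (1 - p e)` makes `c e` a hazard rate, the rate at which an
absent `e` arrives; thinning and Poisson arrivals then obey the same formula. -/
theorem hasDerivAt_productWeight {p : ℝ → α → ℝ} {c : α → ℝ} {t : ℝ}
    (h : ∀ e, HasDerivAt (fun s => p s e) (c e * (1 - p t e)) t) (R : Finset α) :
    HasDerivAt (fun s => productWeight (p s) R) (productWeightDeriv (p t) c R) t := by
  have := HasDerivAt.fun_finsetProd (u := Finset.univ)
    (f := fun e s => if e ∈ R then p s e else 1 - p s e)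
    (f' := fun e => if e ∈ R then c e * (1 - p t e) else -(c e * (1 - p t e))) (x := t) (by
      intro e _
      by_cases he : e ∈ R
      · simpa [he] using h e
      · simpa [he] using (h e).const_sub 1)
  simpa [productWeight, productWeightDeriv, productWeightErase] using this

/-- A Russo-type formula: the derivative of an expectation under a product measure. -/
theorem sum_productWeightDeriv_mul (p c : α → ℝ) (f : Finset α → ℝ) :
    ∑ R, productWeightDeriv p c R * f R =
      ∑ e, c e * ∑ R, productWeight p R * (f (insert e R) - f R) := by
  simp only [productWeightDeriv, Finset.sum_mul]
  rw [Finset.sum_comm]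
  refine Finset.sum_congr rfl fun e _ => ?_
  -- Pair `R` with `insert e R`: both share the erased weight, and `1 - p e` is exactly the factor
  -- that turns it into the weight of the set without `e`.
  rw [sum_eq_sum_filter_notMem_add e, sum_eq_sum_filter_notMem_add e, Finset.mul_sum]
  refine Finset.sum_congr rfl fun R hR => ?_
  simp only [Finset.mem_filter, Finset.mem_univ, true_and] at hR
  rw [productWeight_eq_mul_erase p e R]
  simp only [hR, productWeightErase_insert, Finset.mem_insert_self, if_true, if_false,
    Finset.insert_idem, sub_self, mul_zero, add_zero]
  ring

theorem productWeight_thinning (t : ℝ) (G H : Finset α) :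
    productWeight (thinning t G) H =
      if H ⊆ G then t ^ H.card * (1 - t) ^ (G.card - H.card) else 0 := by
  split_ifs with h
  · have h1 : ∀ e, (if e ∈ H then thinning t G e else 1 - thinning t G e) =
        (if e ∈ H then t else 1) * (if e ∈ G \ H then 1 - t else 1) := by
      intro e
      by_cases h2 : e ∈ H
      · simp [h2, thinning, h h2]
      · by_cases h3 : e ∈ G <;> simp [h2, h3, thinning]
    rw [productWeight, Finset.prod_congr rfl fun e _ => h1 e, Finset.prod_mul_distrib,
      Finset.prod_ite_mem, Finset.prod_ite_mem, Finset.univ_inter, Finset.univ_inter,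
      Finset.prod_const, Finset.prod_const, Finset.card_sdiff_of_subset h]
  · obtain ⟨e, he, heG⟩ := Finset.not_subset.1 h
    exact productWeight_eq_zero he (by simp [thinning, heG])

/-- The number of members of `𝒞` that contain `H`. -/
def extCount (𝒞 : Finset (Finset α)) (H : Finset α) : ℕ := (𝒞.filter fun G => H ⊆ G).card

/-- The coefficients in the interpolation between thinned members of `𝒞` and independent sets. -/
theorem sum_productWeight_thinning_mul {𝒞 : Finset (Finset α)} {m : ℕ}
    (hm : ∀ G ∈ 𝒞, G.card = m) {t : ℝ} (H : Finset α) (e : α) (a b : ℝ) :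
    ∑ G ∈ 𝒞, productWeight (thinning t G) H * ((if e ∈ G then a else 0) - b) =
      t ^ H.card * (1 - t) ^ (m - H.card) *
        (a * extCount 𝒞 (insert e H) - b * extCount 𝒞 H) := by
  -- Since all members have size `m`, the weight of `H` is the same for every `G ⊇ H`: given `H`,
  -- the member is uniform on the extensions of `H`.
  have h1 : ∀ G ∈ 𝒞, productWeight (thinning t G) H * ((if e ∈ G then a else 0) - b) =
      t ^ H.card * (1 - t) ^ (m - H.card) *
        (a * (if insert e H ⊆ G then 1 else 0) - b * if H ⊆ G then 1 else 0) := by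
    intro G hG
    rw [productWeight_thinning, hm G hG]
    by_cases hH : H ⊆ G <;> by_cases he : e ∈ G <;> simp [hH, he, Finset.insert_subset_iff]
  rw [Finset.sum_congr rfl h1, ← Finset.mul_sum, Finset.sum_sub_distrib, ← Finset.mul_sum,
    ← Finset.mul_sum]
  simp [extCount]

/-- The interpolation functional. -/
noncomputable def interpolation (𝒞 : Finset (Finset α)) (θ : α → ℝ) (τ : ℝ) (f : Finset α → ℝ) (t : ℝ) : ℝ :=
  ∑ G ∈ 𝒞, ∑ H, ∑ R, productWeight (thinning t G) H *
    productWeight (fun e => 1 - Real.exp (-(θ e * (τ - t)))) R * f (H ∪ R)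

/-- As t grows, edges of `G` enter `H` at hazard rate (1 - t)⁻¹, while `R` loses arrivals at rate `θ
e`. Both effects act through the same increment of `f` at `H ∪ R`, so the rates may be subtracted.
-/
theorem hasDerivAt_interpolation (𝒞 : Finset (Finset α)) (θ : α → ℝ) (τ : ℝ) (f : Finset α → ℝ)
    {t : ℝ} (ht : t < 1) :
    HasDerivAt (interpolation 𝒞 θ τ f)
      (∑ R, ∑ H, ∑ e, productWeight (fun e => 1 - Real.exp (-(θ e * (τ - t)))) R *
        ((∑ G ∈ 𝒞, productWeight (thinning t G) H * ((if e ∈ G then (1 - t)⁻¹ else 0) - θ e)) *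
          (f (insert e (H ∪ R)) - f (H ∪ R)))) t := by
  set q : ℝ → α → ℝ := fun s e => 1 - Real.exp (-(θ e * (τ - s))) with hq
  have h1 : ∀ G : Finset α, ∀ H, HasDerivAt (fun s => productWeight (thinning s G) H)
      (productWeightDeriv (thinning t G) (fun e => if e ∈ G then (1 - t)⁻¹ else 0) H) t := by
    intro G H
    refine hasDerivAt_productWeight (p := fun s => thinning s G) (fun e => ?_) H
    by_cases he : e ∈ G
    · have : (1 - t)⁻¹ * (1 - t) = 1 := inv_mul_cancel₀ (by linarith)
      simpa [thinning, he, this] using hasDerivAt_id' t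
    · simpa [thinning, he] using hasDerivAt_const t (0 : ℝ)
  have h2 : ∀ R, HasDerivAt (fun s => productWeight (q s) R)
      (productWeightDeriv (q t) (fun e => -θ e) R) t := by
    intro R
    refine hasDerivAt_productWeight (fun e => ?_) R
    have h3 : HasDerivAt (fun s => -(θ e * (τ - s))) (θ e) t := by
      have := (((hasDerivAt_id' t).const_sub τ).const_mul (θ e)).fun_neg
      simpa using this
    have h4 := (h3.exp).const_sub 1
    have h4' : -θ e * (1 - q t e) = -(Real.exp (-(θ e * (τ - t))) * θ e) := by
      simp only [hq]; ring
    rw [h4']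
    exact h4
  have h5 : HasDerivAt (interpolation 𝒞 θ τ f)
      (∑ G ∈ 𝒞, ∑ H, ∑ R,
        (productWeightDeriv (thinning t G) (fun e => if e ∈ G then (1 - t)⁻¹ else 0) H *
          productWeight (q t) R + productWeight (thinning t G) H *
          productWeightDeriv (q t) (fun e => -θ e) R) * f (H ∪ R)) t := by
    unfold interpolation
    refine HasDerivAt.fun_sum fun G _ => HasDerivAt.fun_sum fun H _ => HasDerivAt.fun_sum fun R _ =>
      HasDerivAt.mul_const ((h1 G H).fun_mul (h2 R)) _
  convert h5 using 1
  have h6 : ∀ G ∈ 𝒞, ∑ H, ∑ R,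
        (productWeightDeriv (thinning t G) (fun e => if e ∈ G then (1 - t)⁻¹ else 0) H *
          productWeight (q t) R + productWeight (thinning t G) H *
          productWeightDeriv (q t) (fun e => -θ e) R) * f (H ∪ R) =
      ∑ R, ∑ H, ∑ e, productWeight (q t) R *
        ((productWeight (thinning t G) H * ((if e ∈ G then (1 - t)⁻¹ else 0) - θ e)) *
          (f (insert e (H ∪ R)) - f (H ∪ R))) := by
    intro G _
    have hA : ∑ H, ∑ R, productWeightDeriv (thinning t G)
          (fun e => if e ∈ G then (1 - t)⁻¹ else 0) H * productWeight (q t) R * f (H ∪ R) =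
        ∑ R, ∑ H, ∑ e, productWeight (q t) R * (productWeight (thinning t G) H *
          (if e ∈ G then (1 - t)⁻¹ else 0) * (f (insert e (H ∪ R)) - f (H ∪ R))) := by
      rw [Finset.sum_comm]
      refine Finset.sum_congr rfl fun R _ => ?_
      have := sum_productWeightDeriv_mul (thinning t G)
        (fun e => if e ∈ G then (1 - t)⁻¹ else 0) (fun H => f (H ∪ R))
      rw [Finset.sum_comm (s := Finset.univ (α := Finset α))]
      calc _ = productWeight (q t) R * ∑ H, productWeightDeriv (thinning t G)
            (fun e => if e ∈ G then (1 - t)⁻¹ else 0) H * f (H ∪ R) := by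
            rw [Finset.mul_sum]; exact Finset.sum_congr rfl fun H _ => by ring
        _ = _ := by
            rw [this, Finset.mul_sum]
            refine Finset.sum_congr rfl fun e _ => ?_
            rw [Finset.mul_sum, Finset.mul_sum]
            refine Finset.sum_congr rfl fun H _ => ?_
            rw [Finset.insert_union]; ring
    have hB : ∑ H, ∑ R, productWeight (thinning t G) H *
          productWeightDeriv (q t) (fun e => -θ e) R * f (H ∪ R) =
        ∑ R, ∑ H, ∑ e, productWeight (q t) R * (productWeight (thinning t G) H *
          (-θ e) * (f (insert e (H ∪ R)) - f (H ∪ R))) := by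
      rw [Finset.sum_comm (s := Finset.univ (α := Finset α)) (t := Finset.univ (α := Finset α))
        (f := fun R H => ∑ e, productWeight (q t) R * (productWeight (thinning t G) H *
          (-θ e) * (f (insert e (H ∪ R)) - f (H ∪ R))))]
      refine Finset.sum_congr rfl fun H _ => ?_
      have := sum_productWeightDeriv_mul (q t) (fun e => -θ e) (fun R => f (H ∪ R))
      rw [Finset.sum_comm (s := Finset.univ (α := Finset α))]
      calc _ = productWeight (thinning t G) H *
            ∑ R, productWeightDeriv (q t) (fun e => -θ e) R * f (H ∪ R) := by
            rw [Finset.mul_sum]; exact Finset.sum_congr rfl fun R _ => by ring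
        _ = _ := by
            rw [this, Finset.mul_sum]
            refine Finset.sum_congr rfl fun e _ => ?_
            rw [Finset.mul_sum, Finset.mul_sum]
            refine Finset.sum_congr rfl fun R _ => ?_
            rw [Finset.union_insert]; ring
    simp only [add_mul, Finset.sum_add_distrib]
    rw [hA, hB, ← Finset.sum_add_distrib]
    refine Finset.sum_congr rfl fun R _ => ?_
    rw [← Finset.sum_add_distrib]
    refine Finset.sum_congr rfl fun H _ => ?_
    rw [← Finset.sum_add_distrib]
    exact Finset.sum_congr rfl fun e _ => by ring
  rw [Finset.sum_congr rfl h6, eq_comm, Finset.sum_comm]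
  refine Finset.sum_congr rfl fun R _ => ?_
  rw [Finset.sum_comm]
  refine Finset.sum_congr rfl fun H _ => ?_
  rw [Finset.sum_comm]
  refine Finset.sum_congr rfl fun e _ => ?_
  rw [Finset.sum_mul, Finset.mul_sum]

/-- If, given a typical thinning `H` of a random member of `𝒞`, every `e ∉ H` is still to come with
rate at least `θ e`, then the independent random set with probabilities `1 - exp (-θ e * τ)` is
almost dominated by the random member of `𝒞`. -/
theorem sum_productWeight_mul_le {𝒞 : Finset (Finset α)} {m : ℕ} (hm : ∀ G ∈ 𝒞, G.card = m)
    {θ : α → ℝ} (hθ : ∀ e, 0 ≤ θ e) {τ : ℝ} (hτ0 : 0 ≤ τ) (hτ1 : τ < 1)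
    (good : ℝ → Finset α → Prop) [∀ t, DecidablePred (good t)]
    (hgood : ∀ t, 0 ≤ t → t ≤ τ → ∀ H, good t H → ∀ e, e ∉ H →
      (1 - t) * θ e * extCount 𝒞 H ≤ extCount 𝒞 (insert e H))
    {β : ℝ} (hβ : ∀ t, 0 ≤ t → t ≤ τ → ∀ G ∈ 𝒞,
      ∑ H ∈ Finset.univ.filter (fun H => ¬ good t H), productWeight (thinning t G) H ≤ β)
    {f : Finset α → ℝ} (hf : Monotone f) (hf0 : ∀ S, 0 ≤ f S) (hf1 : ∀ S, f S ≤ 1) :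
    𝒞.card * ∑ R, productWeight (fun e => 1 - Real.exp (-(θ e * τ))) R * f R ≤
      ∑ G ∈ 𝒞, f G + 𝒞.card * (τ * (β * ∑ e, θ e)) := by
  set q : ℝ → α → ℝ := fun s e => 1 - Real.exp (-(θ e * (τ - s))) with hq
  have hqw : ∀ t, t ≤ τ → ∀ R, 0 ≤ productWeight (q t) R := fun t ht R =>
    productWeight_nonneg (fun e => by
      have : Real.exp (-(θ e * (τ - t))) ≤ 1 := Real.exp_le_one_iff.2 (by
        have := mul_nonneg (hθ e) (sub_nonneg.2 ht); linarith)
      simp only [hq]; linarith)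
      (fun e => by have := Real.exp_pos (-(θ e * (τ - t))); simp only [hq]; linarith) R
  have hw : ∀ t, 0 ≤ t → t ≤ τ → ∀ G H : Finset α, 0 ≤ productWeight (thinning t G) H :=
    fun t h0 h1 G H => productWeight_nonneg (thinning_nonneg h0 G)
      (thinning_le_one (by linarith) G) H
  -- For good `H` every coefficient is nonnegative. For bad `H` only the loss `-θ e` is kept,
  -- against increments of `f` that are at most 1.
  have hderiv : ∀ t, 0 ≤ t → t ≤ τ → -(𝒞.card * (β * ∑ e, θ e)) ≤
      ∑ R, ∑ H, ∑ e, productWeight (q t) R *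
        ((∑ G ∈ 𝒞, productWeight (thinning t G) H * ((if e ∈ G then (1 - t)⁻¹ else 0) - θ e)) *
          (f (insert e (H ∪ R)) - f (H ∪ R))) := by
    intro t ht0 ht1
    have hpt : ∀ R H e, productWeight (q t) R * -(if good t H then 0 else
        θ e * ∑ G ∈ 𝒞, productWeight (thinning t G) H) ≤ productWeight (q t) R *
        ((∑ G ∈ 𝒞, productWeight (thinning t G) H * ((if e ∈ G then (1 - t)⁻¹ else 0) - θ e)) *
          (f (insert e (H ∪ R)) - f (H ∪ R))) := by
      intro R H e
      refine mul_le_mul_of_nonneg_left ?_ (hqw t ht1 R)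
      have hΔ0 : 0 ≤ f (insert e (H ∪ R)) - f (H ∪ R) :=
        sub_nonneg.2 (hf (Finset.subset_insert _ _))
      have hΔ1 : f (insert e (H ∪ R)) - f (H ∪ R) ≤ 1 := by
        linarith [hf1 (insert e (H ∪ R)), hf0 (H ∪ R)]
      have hsum0 : 0 ≤ ∑ G ∈ 𝒞, productWeight (thinning t G) H :=
        Finset.sum_nonneg fun G _ => hw t ht0 ht1 G H
      split_ifs with hg
      · rw [neg_zero]
        by_cases he : e ∈ H
        · rw [Finset.insert_eq_of_mem (Finset.mem_union_left _ he), sub_self, mul_zero]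
        · refine mul_nonneg ?_ hΔ0
          rw [sum_productWeight_thinning_mul hm]
          refine mul_nonneg (mul_nonneg (pow_nonneg ht0 _)
            (pow_nonneg (by linarith) _)) ?_
          have h1t : 0 < 1 - t := by linarith
          have := hgood t ht0 ht1 H hg e he
          rw [sub_nonneg, inv_mul_eq_div, le_div_iff₀ h1t]
          linarith
      · have hlow : -(θ e * ∑ G ∈ 𝒞, productWeight (thinning t G) H) ≤
            ∑ G ∈ 𝒞, productWeight (thinning t G) H *
              ((if e ∈ G then (1 - t)⁻¹ else 0) - θ e) := by
          rw [Finset.mul_sum, ← Finset.sum_neg_distrib]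
          refine Finset.sum_le_sum fun G _ => ?_
          have h2 : 0 ≤ if e ∈ G then (1 - t)⁻¹ else 0 := by
            split_ifs
            exacts [inv_nonneg.2 (by linarith), le_rfl]
          nlinarith [hw t ht0 ht1 G H]
        have h3 := mul_nonneg (hθ e) hsum0
        nlinarith
    have hstep := Finset.sum_le_sum fun R (_ : R ∈ Finset.univ) =>
      Finset.sum_le_sum fun H (_ : H ∈ Finset.univ) =>
        Finset.sum_le_sum fun e (_ : e ∈ Finset.univ) => hpt R H e
    refine le_trans ?_ hstep
    have h4 : ∀ R, ∑ H, ∑ e, productWeight (q t) R * -(if good t H then 0 else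
        θ e * ∑ G ∈ 𝒞, productWeight (thinning t G) H) = productWeight (q t) R *
        -((∑ e, θ e) * ∑ G ∈ 𝒞, ∑ H ∈ Finset.univ.filter (fun H => ¬ good t H),
          productWeight (thinning t G) H) := by
      intro R
      simp only [← Finset.mul_sum, Finset.sum_neg_distrib]
      congr 2
      rw [Finset.sum_comm (s := 𝒞), Finset.sum_filter, Finset.sum_mul,
        Finset.sum_comm]
      refine Finset.sum_congr rfl fun e _ => ?_
      rw [Finset.mul_sum]
      refine Finset.sum_congr rfl fun H _ => ?_
      by_cases hg : good t H
      · simp [hg]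
      · simp [hg]
    rw [Finset.sum_congr rfl fun R _ => h4 R, ← Finset.sum_mul, sum_productWeight, one_mul,
      neg_le_neg_iff]
    have h5 : ∑ G ∈ 𝒞, ∑ H ∈ Finset.univ.filter (fun H => ¬ good t H),
          productWeight (thinning t G) H ≤ 𝒞.card * β := by
      rw [← nsmul_eq_mul]
      exact Finset.sum_le_card_nsmul _ _ _ fun G hG => hβ t ht0 ht1 G hG
    calc _ ≤ (∑ e, θ e) * (𝒞.card * β) :=
          mul_le_mul_of_nonneg_left h5 (Finset.sum_nonneg fun e _ => hθ e)
      _ = _ := by ring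
  have hF : ∀ t, t ≤ τ → HasDerivAt (interpolation 𝒞 θ τ f) _ t := fun t ht =>
    hasDerivAt_interpolation 𝒞 θ τ f (ht.trans_lt hτ1)
  have hmvt : -(𝒞.card * (β * ∑ e, θ e)) * (τ - 0) ≤
      interpolation 𝒞 θ τ f τ - interpolation 𝒞 θ τ f 0 := by
    refine (convex_Icc 0 τ).mul_sub_le_image_sub_of_le_deriv
      (fun t ht => (hF t ht.2).continuousAt.continuousWithinAt)
      (fun t ht => (hF t (interior_subset ht).2).differentiableAt.differentiableWithinAt)
      (fun t ht => ?_) 0 ⟨le_rfl, hτ0⟩ τ ⟨hτ0, le_rfl⟩ hτ0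
    have ht := interior_subset ht
    rw [(hF t ht.2).deriv]
    exact hderiv t ht.1 ht.2
  -- At time 0 the thinning is empty and only the independent set remains; at time `τ` the
  -- independent set is empty and `H ⊆ G`.
  have hF0 : interpolation 𝒞 θ τ f 0 =
      𝒞.card * ∑ R, productWeight (fun e => 1 - Real.exp (-(θ e * τ))) R * f R := by
    unfold interpolation
    rw [← nsmul_eq_mul, ← Finset.sum_const]
    refine Finset.sum_congr rfl fun G _ => ?_
    rw [Finset.sum_eq_single ∅]
    · simp [productWeight_thinning]
    · intro H _ hH
      simp [productWeight_thinning, hH]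
    · simp
  have hF1 : interpolation 𝒞 θ τ f τ ≤ ∑ G ∈ 𝒞, f G := by
    unfold interpolation
    refine Finset.sum_le_sum fun G _ => ?_
    have h6 : ∀ H : Finset α, ∑ R, productWeight (thinning τ G) H *
        productWeight (fun e => 1 - Real.exp (-(θ e * (τ - τ)))) R * f (H ∪ R) ≤
        productWeight (thinning τ G) H * f G := by
      intro H
      rw [Finset.sum_eq_single ∅]
      · have : productWeight (fun e => 1 - Real.exp (-(θ e * (τ - τ)))) ∅ = 1 := by
          simp [productWeight]
        rw [this, mul_one, Finset.union_empty]
        by_cases hH : H ⊆ G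
        · exact mul_le_mul_of_nonneg_left (hf hH) (hw τ hτ0 le_rfl G H)
        · simp [productWeight_thinning, hH]
      · intro R _ hR
        obtain ⟨e, he⟩ := Finset.nonempty_iff_ne_empty.2 hR
        rw [productWeight_eq_zero he (by simp)]
        simp
      · simp
    calc _ ≤ ∑ H, productWeight (thinning τ G) H * f G := Finset.sum_le_sum fun H _ => h6 H
      _ = f G := by rw [← Finset.sum_mul, sum_productWeight, one_mul]
  rw [hF0] at hmvt
  linarith

/-- Chernoff bound for the number of elements of `A` in a thinning of `G`. -/
theorem sum_productWeight_thinning_exp_le {t : ℝ} (ht0 : 0 ≤ t) (ht1 : t ≤ 1)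
    (G A : Finset α) (x : ℝ) :
    ∑ H, productWeight (thinning t G) H * Real.exp (x * ((H ∩ A).card : ℝ)) ≤
      Real.exp (t * (Real.exp x - 1) * ((G ∩ A).card : ℝ)) := by
  have h1 : ∀ H : Finset α, Real.exp (x * ((H ∩ A).card : ℝ)) =
      ∏ e ∈ H, if e ∈ A then Real.exp x else 1 := by
    intro H
    rw [Finset.prod_ite_mem, Finset.prod_const, ← Real.exp_nat_mul, mul_comm]
  simp only [h1]
  rw [sum_productWeight_mul_prod, mul_comm _ ((G ∩ A).card : ℝ), Real.exp_nat_mul,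
    ← Finset.prod_const, ← Finset.univ_inter (G ∩ A), ← Finset.prod_ite_mem]
  refine Finset.prod_le_prod (fun e _ => ?_) (fun e _ => ?_)
  · unfold thinning
    by_cases h2 : e ∈ G <;> by_cases h3 : e ∈ A <;> simp [h2, h3]
    nlinarith [mul_nonneg ht0 (Real.exp_pos x).le]
  · unfold thinning
    by_cases h2 : e ∈ G <;> by_cases h3 : e ∈ A <;> simp [h2, h3]
    linarith [Real.add_one_le_exp (t * (Real.exp x - 1))]

end Interpolation

/-! ### Switchings and conditional edge probabilities. -/

section Switching

variable {V : Type*} [Fintype V] [DecidableEq V]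

/-- The number of edges of `E` at `v`. -/
def edgeDeg (E : Finset (Sym2 V)) (v : V) : ℕ := (E.filter fun e => v ∈ e).card

/-- The edge sets of the simple graphs with degree sequence `d`. -/
def degreeFamily (d : V → ℕ) : Finset (Finset (Sym2 V)) :=
  Finset.univ.filter fun G => (∀ e ∈ G, ¬ e.IsDiag) ∧ ∀ v, edgeDeg G v = d v

theorem mem_degreeFamily {d : V → ℕ} {G : Finset (Sym2 V)} :
    G ∈ degreeFamily d ↔ (∀ e ∈ G, ¬ e.IsDiag) ∧ ∀ v, edgeDeg G v = d v := by
  simp [degreeFamily]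

omit [Fintype V] in
theorem edgeDeg_eq_sum (E : Finset (Sym2 V)) (v : V) :
    edgeDeg E v = ∑ e ∈ E, if v ∈ e then 1 else 0 := by
  simp [edgeDeg]

omit [Fintype V] in
theorem edgeDeg_mono {E F : Finset (Sym2 V)} (h : E ⊆ F) (v : V) : edgeDeg E v ≤ edgeDeg F v :=
  Finset.card_le_card (Finset.filter_subset_filter _ h)

omit [Fintype V] in
theorem edgeDeg_sdiff {G H : Finset (Sym2 V)} (h : H ⊆ G) (v : V) :
    edgeDeg (G \ H) v = edgeDeg G v - edgeDeg H v := by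
  unfold edgeDeg
  rw [← Finset.card_sdiff_of_subset (Finset.filter_subset_filter _ h)]
  congr 1
  ext e
  simp only [Finset.mem_filter, Finset.mem_sdiff]
  tauto

theorem card_filter_mk_mem (E : Finset (Sym2 V)) (v : V) :
    (Finset.univ.filter fun a => s(v, a) ∈ E).card = edgeDeg E v := by
  refine Finset.card_bij (fun a _ => s(v, a)) ?_ ?_ ?_
  · intro a ha
    simpa using ha
  · intro a _ b _ hab
    exact Sym2.congr_right.1 hab
  · intro e he
    obtain ⟨heE, hev⟩ := Finset.mem_filter.1 he
    obtain ⟨a, rfl⟩ := hev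
    exact ⟨a, by simpa using heE, rfl⟩

theorem card_filter_fst_mem (E : Finset (Sym2 V)) (S : Finset V) :
    (Finset.univ.filter fun p : V × V => s(p.1, p.2) ∈ E ∧ p.1 ∈ S).card =
      ∑ a ∈ S, edgeDeg E a := by
  rw [Finset.card_filter, Fintype.sum_prod_type, ← Finset.sum_subset (Finset.subset_univ S)]
  · refine Finset.sum_congr rfl fun a ha => ?_
    rw [← card_filter_mk_mem, Finset.card_filter]
    simp [ha]
  · intro a _ ha
    simp [ha]

theorem card_filter_snd_mem (E : Finset (Sym2 V)) (S : Finset V) :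
    (Finset.univ.filter fun p : V × V => s(p.1, p.2) ∈ E ∧ p.2 ∈ S).card =
      ∑ a ∈ S, edgeDeg E a := by
  rw [← card_filter_fst_mem]
  refine Finset.card_bij (fun p _ => p.swap) ?_ ?_ ?_
  · rintro ⟨a, b⟩ h
    simpa [Sym2.eq_swap] using h
  · rintro p - q - h
    exact Prod.swap_injective h
  · rintro ⟨a, b⟩ h
    exact ⟨(b, a), by simpa [Sym2.eq_swap] using h, rfl⟩

theorem card_filter_mk_mem_prod (E : Finset (Sym2 V)) :
    (Finset.univ.filter fun p : V × V => s(p.1, p.2) ∈ E).card = ∑ a, edgeDeg E a := by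
  simpa using card_filter_fst_mem E Finset.univ

/-- The ordered edges `ab` of `E` for which replacing `ab` by `ua` and `vb` creates no loop or
multiple edge in `G`. -/
def switchablePairs (G E : Finset (Sym2 V)) (u v : V) : Finset (V × V) :=
  Finset.univ.filter fun p => s(p.1, p.2) ∈ E ∧
    p.1 ≠ u ∧ s(u, p.1) ∉ G ∧ p.2 ≠ v ∧ s(v, p.2) ∉ G

/-- An ordered edge is excluded only if its first end lies in the closed neighbourhood of `u` or its
second in that of `v`. Each neighbourhood has at most Δ + 1 vertices, each of degree at most Δ. -/
theorem sum_edgeDeg_le_card_switchablePairs {G E : Finset (Sym2 V)} (hE : E ⊆ G) {Δ : ℕ}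
    (hΔ : ∀ v, edgeDeg G v ≤ Δ) (u v : V) :
    ∑ a, edgeDeg E a ≤ (switchablePairs G E u v).card + 2 * (Δ * (Δ + 1)) := by
  have hN : ∀ w, (insert w (Finset.univ.filter fun a => s(w, a) ∈ G)).card ≤ Δ + 1 := fun w =>
    (Finset.card_insert_le _ _).trans (by rw [card_filter_mk_mem]; exact Nat.succ_le_succ (hΔ w))
  have hsum : ∀ w, ∑ a ∈ insert w (Finset.univ.filter fun a => s(w, a) ∈ G), edgeDeg E a ≤
      Δ * (Δ + 1) := by
    intro w
    refine (Finset.sum_le_card_nsmul _ _ Δ fun a _ => (edgeDeg_mono hE a).trans (hΔ a)).trans ?_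
    rw [smul_eq_mul, mul_comm]
    exact Nat.mul_le_mul_left _ (hN w)
  have hsub : (Finset.univ.filter fun p : V × V => s(p.1, p.2) ∈ E) ⊆
      switchablePairs G E u v ∪
        ((Finset.univ.filter fun p : V × V => s(p.1, p.2) ∈ E ∧
          p.1 ∈ insert u (Finset.univ.filter fun a => s(u, a) ∈ G)) ∪
        (Finset.univ.filter fun p : V × V => s(p.1, p.2) ∈ E ∧
          p.2 ∈ insert v (Finset.univ.filter fun a => s(v, a) ∈ G))) := by
    intro p hp
    simp only [switchablePairs, Finset.mem_union, Finset.mem_filter, Finset.mem_univ, true_and,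
      Finset.mem_insert] at hp ⊢
    tauto
  have h1 := Finset.card_le_card hsub
  rw [card_filter_mk_mem_prod] at h1
  have h2 := (h1.trans (Finset.card_union_le _ _)).trans
    (Nat.add_le_add_left (Finset.card_union_le _ _) _)
  rw [card_filter_fst_mem, card_filter_snd_mem] at h2
  linarith [hsum u, hsum v]

/-- Replace the edges `e₁`, `e₂` of `G` by `f₁`, `f₂`. -/
def switchEdges (G : Finset (Sym2 V)) (e₁ e₂ f₁ f₂ : Sym2 V) : Finset (Sym2 V) :=
  (G \ {e₁, e₂}) ∪ {f₁, f₂}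

omit [Fintype V] in
-- A switching can be undone once its edges are known, which makes the maps in the double counts
-- injective.
theorem switchEdges_switchEdges {G : Finset (Sym2 V)} {e₁ e₂ f₁ f₂ : Sym2 V} (h1 : e₁ ∈ G)
    (h2 : e₂ ∈ G) (h3 : f₁ ∉ G) (h4 : f₂ ∉ G) :
    switchEdges (switchEdges G e₁ e₂ f₁ f₂) f₁ f₂ e₁ e₂ = G := by
  ext e
  simp only [switchEdges, Finset.mem_union, Finset.mem_sdiff, Finset.mem_insert,
    Finset.mem_singleton]
  by_cases h5 : e = e₁
  · subst h5; simp [h1]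
  by_cases h6 : e = e₂
  · subst h6; simp [h2]
  by_cases h7 : e = f₁
  · subst h7; simp [h3, h5, h6]
  by_cases h8 : e = f₂
  · subst h8; simp [h4, h5, h6]
  simp [h5, h6, h7, h8]

omit [Fintype V] in
theorem sum_switchEdges_add {G : Finset (Sym2 V)} {e₁ e₂ f₁ f₂ : Sym2 V} (h1 : e₁ ∈ G)
    (h2 : e₂ ∈ G) (h12 : e₁ ≠ e₂) (h3 : f₁ ∉ G) (h4 : f₂ ∉ G) (h34 : f₁ ≠ f₂)
    (x : Sym2 V → ℕ) :
    ∑ e ∈ switchEdges G e₁ e₂ f₁ f₂, x e + (x e₁ + x e₂) = ∑ e ∈ G, x e + (x f₁ + x f₂) := by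
  have hd : Disjoint (G \ {e₁, e₂}) {f₁, f₂} := by
    rw [Finset.disjoint_left]
    intro e he hf
    simp only [Finset.mem_insert, Finset.mem_singleton] at hf
    rcases hf with rfl | rfl
    · exact h3 (Finset.mem_sdiff.1 he).1
    · exact h4 (Finset.mem_sdiff.1 he).1
  have hs : {e₁, e₂} ⊆ G := by
    intro e he
    simp only [Finset.mem_insert, Finset.mem_singleton] at he
    rcases he with rfl | rfl <;> assumption
  rw [switchEdges, Finset.sum_union hd, Finset.sum_pair h34, ← Finset.sum_pair h12,
    ← Finset.sum_sdiff hs]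
  ring

omit [Fintype V] in
theorem indicator_mem_mk {x y : V} (h : x ≠ y) (v : V) :
    (if v ∈ s(x, y) then 1 else 0) = (if v = x then 1 else 0) + if v = y then 1 else 0 := by
  by_cases h1 : v = x
  · subst h1; simp [h]
  · simp [h1]

theorem switchEdges_mem_degreeFamily {d : V → ℕ} {G : Finset (Sym2 V)} (hG : G ∈ degreeFamily d)
    {e₁ e₂ f₁ f₂ : Sym2 V} (h1 : e₁ ∈ G) (h2 : e₂ ∈ G) (h12 : e₁ ≠ e₂) (h3 : f₁ ∉ G) (h4 : f₂ ∉ G)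
    (h34 : f₁ ≠ f₂) (hf₁ : ¬ f₁.IsDiag) (hf₂ : ¬ f₂.IsDiag)
    (hx : ∀ v, ((if v ∈ e₁ then 1 else 0) + (if v ∈ e₂ then 1 else 0) : ℕ) =
      (if v ∈ f₁ then 1 else 0) + if v ∈ f₂ then 1 else 0) :
    switchEdges G e₁ e₂ f₁ f₂ ∈ degreeFamily d := by
  rw [mem_degreeFamily] at hG ⊢
  refine ⟨fun e he => ?_, fun v => ?_⟩
  · simp only [switchEdges, Finset.mem_union, Finset.mem_sdiff, Finset.mem_insert,
      Finset.mem_singleton] at he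
    rcases he with he | rfl | rfl
    · exact hG.1 e he.1
    · exact hf₁
    · exact hf₂
  · have := sum_switchEdges_add h1 h2 h12 h3 h4 h34 (fun e => if v ∈ e then 1 else 0)
    rw [← hG.2 v, edgeDeg_eq_sum, edgeDeg_eq_sum]
    have := hx v
    omega

/-- The number of edges still missing at `v` when the edges of `H` are present. -/
def residualDeg (d : V → ℕ) (H : Finset (Sym2 V)) (v : V) : ℕ := d v - edgeDeg H v

theorem residualDeg_eq_edgeDeg {d : V → ℕ} {G H : Finset (Sym2 V)} (hG : G ∈ degreeFamily d)
    (h : H ⊆ G) (v : V) : residualDeg d H v = edgeDeg (G \ H) v := by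
  rw [edgeDeg_sdiff h, residualDeg, (mem_degreeFamily.1 hG).2]

omit [Fintype V] in
theorem residualDeg_anti (d : V → ℕ) {H K : Finset (Sym2 V)} (h : H ⊆ K) (v : V) :
    residualDeg d K v ≤ residualDeg d H v :=
  Nat.sub_le_sub_left (edgeDeg_mono h v) _

/-- Keeps track of the residual total when edges are revealed one at a time: only the two ends can
lose, one unit each. -/
theorem sum_residualDeg_insert (d : V → ℕ) (H : Finset (Sym2 V)) (e : Sym2 V) :
    ∑ v, residualDeg d H v ≤ ∑ v, residualDeg d (insert e H) v + 2 := by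
  induction e using Sym2.inductionOn with
  | hf x y =>
    have h1 : ∀ v, residualDeg d H v ≤ residualDeg d (insert s(x, y) H) v +
        ((if v = x then 1 else 0) + if v = y then 1 else 0) := by
      intro v
      have h2 : edgeDeg (insert s(x, y) H) v ≤ edgeDeg H v +
          ((if v = x then 1 else 0) + if v = y then 1 else 0) := by
        unfold edgeDeg
        rw [Finset.filter_insert]
        split_ifs with h3 h4 h5 h5
        · exact (Finset.card_insert_le _ _).trans (by omega)
        · exact (Finset.card_insert_le _ _).trans (by omega)
        · exact (Finset.card_insert_le _ _).trans (by omega)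
        · rw [Sym2.mem_iff] at h3; tauto
        all_goals omega
      unfold residualDeg
      omega
    refine (Finset.sum_le_sum fun v _ => h1 v).trans ?_
    simp [Finset.sum_add_distrib]

/-- These pairs index the candidate switchings of `ja`, `kb` into `jk`, `ab`, before checking that
the result is simple. -/
theorem card_backward {d : V → ℕ} {G H : Finset (Sym2 V)} (hG : G ∈ degreeFamily d)
    (h : H ⊆ G) (j k : V) :
    (Finset.univ.filter fun p : V × V => s(j, p.1) ∈ G \ H ∧ s(k, p.2) ∈ G \ H).card =
      residualDeg d H j * residualDeg d H k := by
  rw [residualDeg_eq_edgeDeg hG h, residualDeg_eq_edgeDeg hG h, ← card_filter_mk_mem,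
    ← card_filter_mk_mem, ← Finset.card_product]
  congr 1
  ext p
  simp

theorem filter_insert_subset (d : V → ℕ) (H : Finset (Sym2 V)) (e : Sym2 V) :
    (degreeFamily d).filter (fun G => insert e H ⊆ G) =
      (degreeFamily d).filter fun G => e ∈ G ∧ H ⊆ G := by
  simp only [Finset.insert_subset_iff]

theorem extCount_eq_add (d : V → ℕ) (H : Finset (Sym2 V)) (e : Sym2 V) :
    extCount (degreeFamily d) H = extCount (degreeFamily d) (insert e H) +
      ((degreeFamily d).filter fun G => e ∉ G ∧ H ⊆ G).card := by
  unfold extCount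
  rw [filter_insert_subset, ← Finset.card_filter_add_card_filter_not (fun G => e ∈ G),
    Finset.filter_filter, Finset.filter_filter]
  simp only [and_comm]

/-- Upper bound by switching on the conditional probability of an edge. -/
theorem extCount_insert_mul_le {d : V → ℕ} {Δ : ℕ} (hΔ : ∀ v, d v ≤ Δ) {H : Finset (Sym2 V)}
    {j k : V} (hjk : j ≠ k) (hH : s(j, k) ∉ H) :
    extCount (degreeFamily d) (insert s(j, k) H) * ∑ v, residualDeg d H v ≤
      residualDeg d H j * residualDeg d H k * extCount (degreeFamily d) H +
        extCount (degreeFamily d) (insert s(j, k) H) * (2 * (Δ * (Δ + 1))) := by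
  set A := (degreeFamily d).filter fun G => s(j, k) ∈ G ∧ H ⊆ G with hA
  set B := (degreeFamily d).filter fun G => s(j, k) ∉ G ∧ H ⊆ G with hB
  have hAcard : extCount (degreeFamily d) (insert s(j, k) H) = A.card := by
    rw [extCount, filter_insert_subset]
  have hBcard : B.card ≤ extCount (degreeFamily d) H := by
    rw [extCount_eq_add d H s(j, k)]
    exact Nat.le_add_left _ _
  -- Replace `jk`, `ab` by `ja`, `kb`. No removed edge lies in `H`, so the result still extends `H`;
  -- the pair `(a, b)` is recorded to make the switching reversible.
  have hinj : (A.sigma fun G => switchablePairs G (G \ H) j k).card ≤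
      (B.sigma fun G => Finset.univ.filter fun p : V × V =>
        s(j, p.1) ∈ G \ H ∧ s(k, p.2) ∈ G \ H).card := by
    refine Finset.card_le_card_of_injOn
      (fun x => ⟨switchEdges x.1 s(j, k) s(x.2.1, x.2.2) s(j, x.2.1) s(k, x.2.2), x.2⟩) ?_ ?_
    · rintro ⟨G, a, b⟩ hx
      simp only [Finset.coe_sigma, Set.mem_sigma_iff, Finset.mem_coe, hA, hB, Finset.mem_filter,
        switchablePairs, Finset.mem_univ, true_and, Finset.mem_sdiff] at hx ⊢
      obtain ⟨⟨hG, hjkG, hHG⟩, ⟨habG, habH⟩, haj, hja, hbk, hkb⟩ := hx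
      have hak : a ≠ k := by rintro rfl; exact hja hjkG
      have hbj : b ≠ j := by rintro rfl; rw [Sym2.eq_swap] at hjkG; exact hkb hjkG
      have hab : a ≠ b := by
        rintro rfl; exact (mem_degreeFamily.1 hG).1 _ habG (by simp)
      have h12 : s(j, k) ≠ s(a, b) := by
        simp only [ne_eq, Sym2.eq_iff]; tauto
      have h34 : s(j, a) ≠ s(k, b) := by
        simp only [ne_eq, Sym2.eq_iff]; tauto
      refine ⟨⟨switchEdges_mem_degreeFamily hG hjkG habG h12 hja hkb h34 ?_ ?_ ?_, ?_, ?_⟩, ?_, ?_⟩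
      · simpa using haj.symm
      · simpa using hbk.symm
      · intro v
        rw [indicator_mem_mk hjk, indicator_mem_mk hab, indicator_mem_mk haj.symm,
          indicator_mem_mk hbk.symm]
        ring
      · simp only [switchEdges, Finset.mem_union, Finset.mem_sdiff, Finset.mem_insert,
          Finset.mem_singleton, true_or, not_true, and_false, false_or, Sym2.eq_iff]
        tauto
      · intro e he
        have h1 : e ≠ s(j, k) := by rintro rfl; exact hH he
        have h2 : e ≠ s(a, b) := by rintro rfl; exact habH he
        simp [switchEdges, hHG he, h1, h2]
      · exact ⟨by simp [switchEdges], fun h => hja (hHG h)⟩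
      · exact ⟨by simp [switchEdges], fun h => hkb (hHG h)⟩
    · rintro ⟨G, a, b⟩ hx ⟨G', a', b'⟩ hx' heq
      simp only [Finset.coe_sigma, Set.mem_sigma_iff, Finset.mem_coe, hA, Finset.mem_filter,
        switchablePairs, Finset.mem_univ, true_and, Finset.mem_sdiff] at hx hx'
      simp only [Sigma.mk.injEq, heq_eq_eq, Prod.mk.injEq] at heq
      obtain ⟨h1, rfl, rfl⟩ := heq
      have h2 := switchEdges_switchEdges hx.1.2.1 hx.2.1.1 hx.2.2.2.1 hx.2.2.2.2.2
      have h3 := switchEdges_switchEdges hx'.1.2.1 hx'.2.1.1 hx'.2.2.2.1 hx'.2.2.2.2.2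
      rw [h1, h3] at h2
      rw [h2]
  rw [Finset.card_sigma, Finset.card_sigma] at hinj
  have hleft : A.card * ∑ v, residualDeg d H v ≤
      ∑ G ∈ A, (switchablePairs G (G \ H) j k).card + A.card * (2 * (Δ * (Δ + 1))) := by
    rw [← smul_eq_mul, ← Finset.sum_const, ← smul_eq_mul, ← Finset.sum_const,
      ← Finset.sum_add_distrib]
    refine Finset.sum_le_sum fun G hG => ?_
    obtain ⟨hGd, -, hHG⟩ := Finset.mem_filter.1 hG
    rw [Finset.sum_congr rfl fun v _ => residualDeg_eq_edgeDeg hGd hHG v]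
    exact sum_edgeDeg_le_card_switchablePairs Finset.sdiff_subset
      (fun v => by rw [(mem_degreeFamily.1 hGd).2]; exact hΔ v) j k
  have hright : ∑ G ∈ B, (Finset.univ.filter fun p : V × V =>
      s(j, p.1) ∈ G \ H ∧ s(k, p.2) ∈ G \ H).card = residualDeg d H j * residualDeg d H k * B.card := by
    rw [mul_comm, ← smul_eq_mul, ← Finset.sum_const]
    refine Finset.sum_congr rfl fun G hG => ?_
    obtain ⟨hGd, -, hHG⟩ := Finset.mem_filter.1 hG
    exact card_backward hGd hHG j k
  rw [hAcard]
  have := Nat.mul_le_mul_left (residualDeg d H j * residualDeg d H k) hBcard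
  omega

/-- Lower bound by switching on the conditional probability of an edge, with the number of
unswitchable paths still to be estimated. -/
theorem mul_extCount_le_add_sum {d : V → ℕ} {H : Finset (Sym2 V)}
    {j k : V} (hjk : j ≠ k) (hH : s(j, k) ∉ H) :
    residualDeg d H j * residualDeg d H k * extCount (degreeFamily d) H ≤
      (∑ v, residualDeg d H v + residualDeg d H j * residualDeg d H k) *
        extCount (degreeFamily d) (insert s(j, k) H) +
      residualDeg d H j * extCount (degreeFamily d) H +
      ∑ G ∈ (degreeFamily d).filter (fun G => s(j, k) ∉ G ∧ H ⊆ G),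
        (Finset.univ.filter fun p : V × V =>
          s(j, p.1) ∈ G \ H ∧ s(k, p.2) ∈ G \ H ∧ s(p.1, p.2) ∈ G).card := by
  set A := (degreeFamily d).filter fun G => s(j, k) ∈ G ∧ H ⊆ G with hA
  set B := (degreeFamily d).filter fun G => s(j, k) ∉ G ∧ H ⊆ G with hB
  have hAcard : extCount (degreeFamily d) (insert s(j, k) H) = A.card := by
    rw [extCount, filter_insert_subset]
  have hBcard : extCount (degreeFamily d) H = A.card + B.card := by
    rw [extCount_eq_add d H s(j, k), hAcard]
  -- The reverse switching: `ja`, `kb` become `jk`, `ab`, which requires `a ≠ b` and `ab` to be a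
  -- non-edge.
  have hinj : (B.sigma fun G => Finset.univ.filter fun p : V × V =>
        s(j, p.1) ∈ G \ H ∧ s(k, p.2) ∈ G \ H ∧ p.1 ≠ p.2 ∧ s(p.1, p.2) ∉ G).card ≤
      (A.sigma fun G => Finset.univ.filter fun p : V × V => s(p.1, p.2) ∈ G \ H).card := by
    refine Finset.card_le_card_of_injOn
      (fun x => ⟨switchEdges x.1 s(j, x.2.1) s(k, x.2.2) s(j, k) s(x.2.1, x.2.2), x.2⟩) ?_ ?_
    · rintro ⟨G, a, b⟩ hx
      simp only [Finset.coe_sigma, Set.mem_sigma_iff, Finset.mem_coe, hA, hB, Finset.mem_filter,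
        Finset.mem_univ, true_and, Finset.mem_sdiff] at hx ⊢
      obtain ⟨⟨hG, hjkG, hHG⟩, ⟨hjaG, hjaH⟩, ⟨hkbG, hkbH⟩, hab, habG⟩ := hx
      have hak : a ≠ k := by rintro rfl; exact hjkG hjaG
      have hbj : b ≠ j := by rintro rfl; rw [Sym2.eq_swap] at hjkG; exact hjkG hkbG
      have haj : a ≠ j := by
        rintro rfl; exact (mem_degreeFamily.1 hG).1 _ hjaG (by simp)
      have hbk : b ≠ k := by
        rintro rfl; exact (mem_degreeFamily.1 hG).1 _ hkbG (by simp)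
      have h12 : s(j, a) ≠ s(k, b) := by
        simp only [ne_eq, Sym2.eq_iff]; tauto
      have h34 : s(j, k) ≠ s(a, b) := by
        simp only [ne_eq, Sym2.eq_iff]; tauto
      refine ⟨⟨switchEdges_mem_degreeFamily hG hjaG hkbG h12 hjkG habG h34 ?_ ?_ ?_, ?_, ?_⟩, ?_, ?_⟩
      · simpa using hjk
      · simpa using hab
      · intro v
        rw [indicator_mem_mk hjk, indicator_mem_mk hab, indicator_mem_mk haj.symm,
          indicator_mem_mk hbk.symm]
        ring
      · simp [switchEdges]
      · intro e he
        have h1 : e ≠ s(j, a) := by rintro rfl; exact hjaH he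
        have h2 : e ≠ s(k, b) := by rintro rfl; exact hkbH he
        simp [switchEdges, hHG he, h1, h2]
      · simp [switchEdges]
      · exact fun h => habG (hHG h)
    · rintro ⟨G, a, b⟩ hx ⟨G', a', b'⟩ hx' heq
      simp only [Finset.coe_sigma, Set.mem_sigma_iff, Finset.mem_coe, hB, Finset.mem_filter,
        Finset.mem_univ, true_and, Finset.mem_sdiff] at hx hx'
      simp only [Sigma.mk.injEq, heq_eq_eq, Prod.mk.injEq] at heq
      obtain ⟨h1, rfl, rfl⟩ := heq
      have h2 := switchEdges_switchEdges hx.2.1.1 hx.2.2.1.1 hx.1.2.1 hx.2.2.2.2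
      have h3 := switchEdges_switchEdges hx'.2.1.1 hx'.2.2.1.1 hx'.1.2.1 hx'.2.2.2.2
      rw [h1, h3] at h2
      rw [h2]
  rw [Finset.card_sigma, Finset.card_sigma] at hinj
  have hright : ∑ G ∈ A, (Finset.univ.filter fun p : V × V => s(p.1, p.2) ∈ G \ H).card =
      A.card * ∑ v, residualDeg d H v := by
    rw [← smul_eq_mul, ← Finset.sum_const]
    refine Finset.sum_congr rfl fun G hG => ?_
    obtain ⟨hGd, -, hHG⟩ := Finset.mem_filter.1 hG
    rw [card_filter_mk_mem_prod, Finset.sum_congr rfl fun v _ => residualDeg_eq_edgeDeg hGd hHG v]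
  -- A candidate pair fails either because `ab` is already an edge or because `a = b`; the latter
  -- happens at most `residualDeg d H j` times.
  have hleft : B.card * (residualDeg d H j * residualDeg d H k) ≤
      ∑ G ∈ B, ((Finset.univ.filter fun p : V × V =>
        s(j, p.1) ∈ G \ H ∧ s(k, p.2) ∈ G \ H ∧ p.1 ≠ p.2 ∧ s(p.1, p.2) ∉ G).card +
        (Finset.univ.filter fun p : V × V =>
          s(j, p.1) ∈ G \ H ∧ s(k, p.2) ∈ G \ H ∧ s(p.1, p.2) ∈ G).card +
        residualDeg d H j) := by
    rw [← smul_eq_mul, ← Finset.sum_const]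
    refine Finset.sum_le_sum fun G hG => ?_
    obtain ⟨hGd, -, hHG⟩ := Finset.mem_filter.1 hG
    rw [← card_backward hGd hHG j k, residualDeg_eq_edgeDeg hGd hHG, ← card_filter_mk_mem,
      ← Finset.card_image_of_injective (Finset.univ.filter fun a => s(j, a) ∈ G \ H)
        (f := fun a => (a, a)) (fun a b h => (Prod.mk.inj h).1)]
    refine (Finset.card_le_card ?_).trans ((Finset.card_union_le _ _).trans
      (Nat.add_le_add_right (Finset.card_union_le _ _) _))
    rintro ⟨a, b⟩ hp
    simp only [Finset.mem_union, Finset.mem_filter, Finset.mem_univ, true_and,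
      Finset.mem_image, Prod.mk.injEq] at hp ⊢
    by_cases hab : a = b
    · subst hab
      exact Or.inr ⟨a, hp.1, rfl, rfl⟩
    · by_cases habG : s(a, b) ∈ G
      · exact Or.inl (Or.inr ⟨hp.1, hp.2, habG⟩)
      · exact Or.inl (Or.inl ⟨hp.1, hp.2, hab, habG⟩)
  simp only [Finset.sum_add_distrib, Finset.sum_const, smul_eq_mul] at hleft
  rw [hright] at hinj
  rw [hAcard, hBcard]
  nlinarith [Nat.zero_le (residualDeg d H j * A.card)]

/-- Upper bound by switching on the conditional probability of an edge. -/
theorem extCount_insert_mul_le_of_le {d : V → ℕ} {Δ : ℕ} (hΔ : ∀ v, d v ≤ Δ)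
    {H : Finset (Sym2 V)} {j k : V} (hjk : j ≠ k) (hH : s(j, k) ∉ H) {X : ℝ}
    (hX : X + 2 * (Δ * (Δ + 1)) ≤ (∑ v, residualDeg d H v : ℕ)) :
    extCount (degreeFamily d) (insert s(j, k) H) * X ≤
      residualDeg d H j * residualDeg d H k * (extCount (degreeFamily d) H : ℝ) := by
  have h1 : ((extCount (degreeFamily d) (insert s(j, k) H) * ∑ v, residualDeg d H v : ℕ) : ℝ) ≤
      _ := Nat.cast_le.2 (extCount_insert_mul_le hΔ hjk hH)
  rw [Nat.cast_mul] at h1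
  rw [Nat.cast_add, Nat.cast_mul, Nat.cast_mul, Nat.cast_mul _ (2 * (Δ * (Δ + 1)))] at h1
  have h2 := mul_le_mul_of_nonneg_left hX
    (Nat.cast_nonneg (α := ℝ) (extCount (degreeFamily d) (insert s(j, k) H)))
  push_cast at h1 h2 ⊢
  linarith

/-- The expected number of unswitchable paths. -/
theorem sum_card_paths_mul_le {d : V → ℕ} {Δ : ℕ} (hΔ : ∀ v, d v ≤ Δ) {H : Finset (Sym2 V)}
    {j k : V} (hjk : j ≠ k) {X : ℝ} (hX0 : 0 ≤ X)
    (hX : X + 2 * (Δ * (Δ + 1)) + 4 ≤ (∑ v, residualDeg d H v : ℕ)) :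
    (∑ G ∈ (degreeFamily d).filter (fun G => s(j, k) ∉ G ∧ H ⊆ G),
        (Finset.univ.filter fun p : V × V =>
          s(j, p.1) ∈ G \ H ∧ s(k, p.2) ∈ G \ H ∧ s(p.1, p.2) ∈ G).card : ℕ) * X ^ 2 ≤
      residualDeg d H j * residualDeg d H k * ((Δ : ℝ) ^ 2 * (∑ v, d v : ℕ)) *
        extCount (degreeFamily d) H := by
  set B := (degreeFamily d).filter fun G => s(j, k) ∉ G ∧ H ⊆ G with hB
  -- Reveal `ab`, then `ja`, then `kb`. The last two steps are bounded by the upper switching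
  -- estimate, each costing a residual degree times Δ / X; the 4 in `hX` pays for the two insertions
  -- made before. The sum over `ab` is then exact, since every member has ∑ d ordered edges.
  have hpair : ∀ p : V × V,
      ((B.filter fun G => s(j, p.1) ∈ G \ H ∧ s(k, p.2) ∈ G \ H ∧ s(p.1, p.2) ∈ G).card : ℝ) *
        X ^ 2 ≤ residualDeg d H j * residualDeg d H k * (Δ : ℝ) ^ 2 *
          extCount (degreeFamily d) (insert s(p.1, p.2) H) := by
    rintro ⟨a, b⟩
    dsimp only
    rcases Finset.eq_empty_or_nonempty (B.filter fun G =>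
      s(j, a) ∈ G \ H ∧ s(k, b) ∈ G \ H ∧ s(a, b) ∈ G) with h0 | ⟨G, hG⟩
    · rw [h0]; simp only [Finset.card_empty, Nat.cast_zero, zero_mul]; positivity
    simp only [hB, Finset.mem_filter, Finset.mem_sdiff] at hG
    obtain ⟨⟨hG, hjkG, hHG⟩, ⟨hjaG, hjaH⟩, ⟨hkbG, hkbH⟩, habG⟩ := hG
    have hak : a ≠ k := by rintro rfl; exact hjkG hjaG
    have hbj : b ≠ j := by rintro rfl; rw [Sym2.eq_swap] at hjkG; exact hjkG hkbG
    have haj : a ≠ j := by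
      rintro rfl; exact (mem_degreeFamily.1 hG).1 _ hjaG (by simp)
    have hbk : b ≠ k := by
      rintro rfl; exact (mem_degreeFamily.1 hG).1 _ hkbG (by simp)
    have h1 : s(j, a) ∉ insert s(a, b) H := by
      rw [Finset.mem_insert, not_or]
      refine ⟨?_, hjaH⟩
      simp only [Sym2.eq_iff]; tauto
    have h2 : s(k, b) ∉ insert s(j, a) (insert s(a, b) H) := by
      rw [Finset.mem_insert, Finset.mem_insert, not_or, not_or]
      refine ⟨?_, ?_, hkbH⟩ <;> simp only [Sym2.eq_iff] <;> tauto
    have hsum1 := sum_residualDeg_insert d H s(a, b)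
    have hsum2 := sum_residualDeg_insert d (insert s(a, b) H) s(j, a)
    have hsum1' : ((∑ v, residualDeg d H v : ℕ) : ℝ) ≤
      (∑ v, residualDeg d (insert s(a, b) H) v : ℕ) + 2 := by exact_mod_cast hsum1
    have hsum2' : ((∑ v, residualDeg d (insert s(a, b) H) v : ℕ) : ℝ) ≤
      (∑ v, residualDeg d (insert s(j, a) (insert s(a, b) H)) v : ℕ) + 2 := by
      exact_mod_cast hsum2
    have h3 := extCount_insert_mul_le_of_le hΔ haj.symm h1 (X := X) (by linarith)
    have h4 := extCount_insert_mul_le_of_le hΔ hbk.symm h2 (X := X) (by linarith)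
    have h5 : (B.filter fun G => s(j, a) ∈ G \ H ∧ s(k, b) ∈ G \ H ∧ s(a, b) ∈ G).card ≤
        extCount (degreeFamily d) (insert s(k, b) (insert s(j, a) (insert s(a, b) H))) := by
      refine Finset.card_le_card fun G hG => ?_
      simp only [hB, Finset.mem_filter, Finset.mem_sdiff, Finset.insert_subset_iff] at hG ⊢
      tauto
    have h5' : ((B.filter fun G => s(j, a) ∈ G \ H ∧ s(k, b) ∈ G \ H ∧ s(a, b) ∈ G).card : ℝ) ≤
        extCount (degreeFamily d) (insert s(k, b) (insert s(j, a) (insert s(a, b) H))) := by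
      exact_mod_cast h5
    have hres : ∀ (K : Finset (Sym2 V)) x y, H ⊆ K →
        (residualDeg d K x * residualDeg d K y : ℝ) ≤ residualDeg d H x * Δ := by
      intro K x y hK
      have h6 : (residualDeg d K x : ℝ) ≤ residualDeg d H x := by
        exact_mod_cast residualDeg_anti d hK x
      have h7 : (residualDeg d K y : ℝ) ≤ Δ := by
        exact_mod_cast (Nat.sub_le _ _).trans (hΔ y)
      exact mul_le_mul h6 h7 (Nat.cast_nonneg _) (Nat.cast_nonneg _)
    have hs1 : H ⊆ insert s(a, b) H := Finset.subset_insert _ _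
    have hs2 : H ⊆ insert s(j, a) (insert s(a, b) H) := hs1.trans (Finset.subset_insert _ _)
    have h3' := h3.trans (mul_le_mul_of_nonneg_right (hres _ j a hs1) (Nat.cast_nonneg _))
    have h4' := h4.trans (mul_le_mul_of_nonneg_right (hres _ k b hs2) (Nat.cast_nonneg _))
    calc _ ≤ (extCount (degreeFamily d)
            (insert s(k, b) (insert s(j, a) (insert s(a, b) H))) * X) * X := by
          rw [pow_two, ← mul_assoc]
          exact mul_le_mul_of_nonneg_right (mul_le_mul_of_nonneg_right h5' hX0) hX0
      _ ≤ (residualDeg d H k * Δ *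
            extCount (degreeFamily d) (insert s(j, a) (insert s(a, b) H))) * X :=
          mul_le_mul_of_nonneg_right h4' hX0
      _ = residualDeg d H k * Δ *
            (extCount (degreeFamily d) (insert s(j, a) (insert s(a, b) H)) * X) := by ring
      _ ≤ residualDeg d H k * Δ * (residualDeg d H j * Δ *
            extCount (degreeFamily d) (insert s(a, b) H)) :=
          mul_le_mul_of_nonneg_left h3' (by positivity)
      _ = _ := by ring
  have hswap : ∑ G ∈ B, (Finset.univ.filter fun p : V × V =>
          s(j, p.1) ∈ G \ H ∧ s(k, p.2) ∈ G \ H ∧ s(p.1, p.2) ∈ G).card =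
      ∑ p : V × V, (B.filter fun G =>
        s(j, p.1) ∈ G \ H ∧ s(k, p.2) ∈ G \ H ∧ s(p.1, p.2) ∈ G).card := by
    simp only [Finset.card_filter]
    exact Finset.sum_comm
  have htotal : ∑ p : V × V, extCount (degreeFamily d) (insert s(p.1, p.2) H) =
      (∑ v, d v) * extCount (degreeFamily d) H := by
    have h8 : ∀ p : V × V, extCount (degreeFamily d) (insert s(p.1, p.2) H) =
        (((degreeFamily d).filter fun G => H ⊆ G).filter fun G => s(p.1, p.2) ∈ G).card := by
      intro p
      rw [extCount, filter_insert_subset, Finset.filter_filter]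
      simp only [and_comm]
    simp only [h8, Finset.card_filter]
    rw [Finset.sum_comm]
    simp only [← Finset.card_filter, card_filter_mk_mem_prod]
    rw [mul_comm, extCount, ← smul_eq_mul, ← Finset.sum_const]
    refine Finset.sum_congr rfl fun G hG => ?_
    simp only [(mem_degreeFamily.1 (Finset.mem_filter.1 hG).1).2]
  rw [hswap, Nat.cast_sum, Finset.sum_mul]
  refine (Finset.sum_le_sum fun p _ => hpair p).trans ?_
  rw [← Finset.mul_sum, ← Nat.cast_sum, htotal, Nat.cast_mul]
  exact le_of_eq (by ring)

/-- Lower bound by switching on the conditional probability of an edge. -/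
theorem mul_extCount_le {d : V → ℕ} {Δ : ℕ} (hΔ : ∀ v, d v ≤ Δ) {H : Finset (Sym2 V)}
    {j k : V} (hjk : j ≠ k) (hH : s(j, k) ∉ H) {X : ℝ} (hX0 : 0 < X)
    (hX : X + 2 * (Δ * (Δ + 1)) + 4 ≤ (∑ v, residualDeg d H v : ℕ)) :
    residualDeg d H j * residualDeg d H k * (extCount (degreeFamily d) H : ℝ) ≤
      ((∑ v, residualDeg d H v : ℕ) + residualDeg d H j * residualDeg d H k) *
        extCount (degreeFamily d) (insert s(j, k) H) +
      residualDeg d H j * extCount (degreeFamily d) H +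
      residualDeg d H j * residualDeg d H k * ((Δ : ℝ) ^ 2 * (∑ v, d v : ℕ) / X ^ 2) *
        extCount (degreeFamily d) H := by
  have h1 := mul_extCount_le_add_sum (d := d) hjk hH
  have h2 := sum_card_paths_mul_le hΔ hjk hX0.le hX
  set S := ∑ G ∈ (degreeFamily d).filter (fun G => s(j, k) ∉ G ∧ H ⊆ G),
        (Finset.univ.filter fun p : V × V =>
          s(j, p.1) ∈ G \ H ∧ s(k, p.2) ∈ G \ H ∧ s(p.1, p.2) ∈ G).card
  have h3 : (S : ℝ) ≤ residualDeg d H j * residualDeg d H k *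
      ((Δ : ℝ) ^ 2 * (∑ v, d v : ℕ) / X ^ 2) * extCount (degreeFamily d) H := by
    rw [← le_div_iff₀ (by positivity)] at h2
    refine h2.trans (le_of_eq ?_)
    ring
  have h1' : ((residualDeg d H j * residualDeg d H k * extCount (degreeFamily d) H : ℕ) : ℝ) ≤
    _ := Nat.cast_le.2 h1
  push_cast at h1' h3 ⊢
  linarith

end Switching

/-! ### Existence of graphs with the prescribed degrees. -/

section Existence

variable {V : Type*} [Fintype V] [DecidableEq V]

theorem sum_edgeDeg {G : Finset (Sym2 V)} (hG : ∀ e ∈ G, ¬ e.IsDiag) :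
    ∑ v, edgeDeg G v = 2 * G.card := by
  simp only [edgeDeg_eq_sum]
  rw [Finset.sum_comm, mul_comm, ← smul_eq_mul, ← Finset.sum_const]
  refine Finset.sum_congr rfl fun e he => ?_
  have := hG e he
  induction e using Sym2.inductionOn with
  | hf x y =>
    have hxy : x ≠ y := by simpa using this
    simp only [indicator_mem_mk hxy, Finset.sum_add_distrib, Finset.sum_ite_eq', Finset.mem_univ,
      if_true]

omit [Fintype V] in
theorem edgeDeg_insert {G : Finset (Sym2 V)} {e : Sym2 V} (he : e ∉ G) (v : V) :
    edgeDeg (insert e G) v = edgeDeg G v + if v ∈ e then 1 else 0 := by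
  rw [edgeDeg_eq_sum, edgeDeg_eq_sum, Finset.sum_insert he, add_comm]

omit [Fintype V] in
theorem edgeDeg_erase {G : Finset (Sym2 V)} {e : Sym2 V} (he : e ∈ G) (v : V) :
    edgeDeg (G.erase e) v + (if v ∈ e then 1 else 0) = edgeDeg G v := by
  rw [edgeDeg_eq_sum, edgeDeg_eq_sum, Finset.sum_erase_add _ _ he]

/-- A sequence with even sum whose maximum is small compared to the sum is graphical. -/
theorem degreeFamily_nonempty {d : V → ℕ} {Δ : ℕ} (hΔ : ∀ v, d v ≤ Δ) (heven : Even (∑ v, d v))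
    (hM : 3 * (Δ * (Δ + 1)) < ∑ v, d v) : (degreeFamily d).Nonempty := by
  -- Take a graph with degrees at most `d` and as many edges as possible; a deficient vertex will
  -- allow one more edge.
  let S : Finset (Finset (Sym2 V)) := Finset.univ.filter fun G =>
    (∀ e ∈ G, ¬ e.IsDiag) ∧ ∀ v, edgeDeg G v ≤ d v
  obtain ⟨G, hG, hmax⟩ := S.exists_max_image Finset.card ⟨∅,
    Finset.mem_filter.2 ⟨Finset.mem_univ _, by simp, by simp [edgeDeg]⟩⟩
  simp only [S, Finset.mem_filter, Finset.mem_univ, true_and] at hG hmax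
  obtain ⟨hloop, hdeg⟩ := hG
  have hdegΔ : ∀ v, edgeDeg G v ≤ Δ := fun v => (hdeg v).trans (hΔ v)
  by_contra hne
  have hdef : ∃ u, edgeDeg G u < d u := by
    by_contra! h
    exact hne ⟨G, mem_degreeFamily.2 ⟨hloop, fun v => le_antisymm (hdeg v) (h v)⟩⟩
  have hN : ∀ w, (insert w (Finset.univ.filter fun a => s(w, a) ∈ G)).card ≤ Δ + 1 := fun w =>
    (Finset.card_insert_le _ _).trans
      (by rw [card_filter_mk_mem]; exact Nat.succ_le_succ (hdegΔ w))
  have hsplit : ∑ v, d v = ∑ v, edgeDeg G v + ∑ v, (d v - edgeDeg G v) := by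
    rw [← Finset.sum_add_distrib]
    exact Finset.sum_congr rfl fun v _ => (Nat.add_sub_of_le (hdeg v)).symm
  obtain ⟨u, hu⟩ := hdef
  -- With few edges the total deficiency exceeds Δ(Δ + 1), so there are more than Δ + 1 deficient
  -- vertices and one of them can be joined to `u`. With many edges some edge `ab` can be replaced
  -- by `ua` and `vb`, a gain of one edge.
  rcases le_or_gt (∑ v, edgeDeg G v) (2 * (Δ * (Δ + 1))) with hB | hA
  · have h1 : ∑ v, (d v - edgeDeg G v) ≤
        (Finset.univ.filter fun v => edgeDeg G v < d v).card * Δ := by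
      rw [← smul_eq_mul, ← Finset.sum_const, Finset.sum_filter]
      refine Finset.sum_le_sum fun v _ => ?_
      split_ifs with h
      · exact (Nat.sub_le _ _).trans (hΔ v)
      · omega
    have h2 : (insert u (Finset.univ.filter fun a => s(u, a) ∈ G)).card <
        (Finset.univ.filter fun v => edgeDeg G v < d v).card := by
      refine (hN u).trans_lt ?_
      by_contra! h3
      have := Nat.mul_le_mul_right Δ h3
      nlinarith
    obtain ⟨v, hv, hvu⟩ := Finset.exists_mem_notMem_of_card_lt_card h2
    simp only [Finset.mem_filter, Finset.mem_univ, true_and, Finset.mem_insert, not_or] at hv hvu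
    have huv : u ≠ v := fun h => hvu.1 h.symm
    have h4 := hmax (insert s(u, v) G) ⟨fun e he => ?_, fun w => ?_⟩
    · rw [Finset.card_insert_of_notMem hvu.2] at h4; omega
    · rcases Finset.mem_insert.1 he with rfl | he
      · simpa using huv
      · exact hloop e he
    · rw [edgeDeg_insert hvu.2, indicator_mem_mk huv]
      have := hdeg w
      by_cases h5 : w = u
      · subst h5; simp [huv]; omega
      · by_cases h6 : w = v
        · subst h6; simp [h5]; omega
        · simp [h5, h6, this]
  -- If `u` is the only deficient vertex, parity makes its deficiency at least 2, and `v = u` is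
  -- allowed.
  · obtain ⟨v, hv⟩ : ∃ v, ∀ w, edgeDeg G w +
        ((if w = u then 1 else 0) + if w = v then 1 else 0) ≤ d w := by
      by_cases h : ∃ v, v ≠ u ∧ edgeDeg G v < d v
      · obtain ⟨v, hvu, hv⟩ := h
        refine ⟨v, fun w => ?_⟩
        have := hdeg w
        by_cases h5 : w = u
        · subst h5; simp [hvu.symm]; omega
        · by_cases h6 : w = v
          · subst h6; simp [h5]; omega
          · simp [h5, h6, this]
      · push Not at h
        refine ⟨u, fun w => ?_⟩
        by_cases h5 : w = u
        · subst h5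
          have h6 : ∑ v, (d v - edgeDeg G v) = d w - edgeDeg G w :=
            Finset.sum_eq_single w (fun v _ hv => Nat.sub_eq_zero_of_le (h v hv)) (by simp)
          rw [h6, sum_edgeDeg hloop] at hsplit
          obtain ⟨r, hr⟩ := heven
          simp
          omega
        · simp [h5, hdeg w]
    have h1 := sum_edgeDeg_le_card_switchablePairs (subset_refl G) hdegΔ u v
    have h2 : 0 < (switchablePairs G G u v).card := by omega
    obtain ⟨⟨a, b⟩, hab⟩ := Finset.card_pos.1 h2
    simp only [switchablePairs, Finset.mem_filter, Finset.mem_univ, true_and] at hab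
    obtain ⟨habG, hau, hua, hbv, hvb⟩ := hab
    have hne' : a ≠ b := by rintro rfl; exact hloop _ habG (by simp)
    have h3 : s(v, b) ∉ G.erase s(a, b) := fun h => hvb (Finset.mem_of_mem_erase h)
    have h4 : s(u, a) ∉ insert s(v, b) (G.erase s(a, b)) := by
      rw [Finset.mem_insert, not_or]
      refine ⟨?_, fun h => hua (Finset.mem_of_mem_erase h)⟩
      rw [Sym2.eq_iff]
      rintro (⟨-, h⟩ | ⟨rfl, rfl⟩)
      · exact hne' h
      · rw [Sym2.eq_swap] at habG; exact hua habG
    have h5 := hmax (insert s(u, a) (insert s(v, b) (G.erase s(a, b)))) ⟨fun e he => ?_, fun w => ?_⟩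
    · rw [Finset.card_insert_of_notMem h4, Finset.card_insert_of_notMem h3,
        Finset.card_erase_of_mem habG] at h5
      have := Finset.card_pos.2 ⟨_, habG⟩
      omega
    · rcases Finset.mem_insert.1 he with rfl | he
      · simpa using hau.symm
      rcases Finset.mem_insert.1 he with rfl | he
      · simpa using hbv.symm
      · exact hloop e (Finset.mem_of_mem_erase he)
    · have h6 := edgeDeg_erase habG w
      have h7 := hv w
      rw [indicator_mem_mk hne'] at h6
      rw [edgeDeg_insert h4, edgeDeg_insert h3, indicator_mem_mk hau.symm,
        indicator_mem_mk hbv.symm]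
      omega

end Existence

/-! ### Chernoff bounds for thinnings. -/

section Chernoff

variable {α : Type*} [DecidableEq α] [Fintype α]

theorem exp_le_one_add_add_sq {x : ℝ} (hx : |x| ≤ 1) : Real.exp x ≤ 1 + x + x ^ 2 := by
  have := Real.abs_exp_sub_one_sub_id_le hx
  linarith [le_abs_self (Real.exp x - 1 - x)]

/-- One-sided Chernoff bound, with the sign of the deviation as a parameter. -/
theorem sum_productWeight_thinning_filter_le {t : ℝ} (ht0 : 0 ≤ t) (ht1 : t ≤ 1)
    (G A : Finset α) {κ : ℝ} (hκ0 : 0 ≤ κ) (hκ1 : κ ≤ 2) {σ : ℝ} (hσ : σ ^ 2 = 1) :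
    ∑ H ∈ Finset.univ.filter (fun H : Finset α => κ * ((G ∩ A).card : ℝ) <
        σ * (((H ∩ A).card : ℝ) - t * ((G ∩ A).card : ℝ))), productWeight (thinning t G) H ≤
      Real.exp (-(κ ^ 2 / 4 * ((G ∩ A).card : ℝ))) := by
  set D : ℝ := ((G ∩ A).card : ℝ)
  have hD : 0 ≤ D := Nat.cast_nonneg _
  -- With this exponent the deviation contributes -κ²/2 and the second-order term at most x² = κ²/4;
  -- `κ ≤ 2` ensures |x| ≤ 1.
  set x : ℝ := σ * (κ / 2) with hx
  have hx2 : x ^ 2 = κ ^ 2 / 4 := by rw [hx, mul_pow, hσ]; ring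
  have hσx : σ * x = κ / 2 := by rw [hx, ← mul_assoc, ← pow_two, hσ, one_mul]
  have hxabs : |x| ≤ 1 := by
    rw [← sq_le_one_iff_abs_le_one, hx2]; nlinarith
  have hw : ∀ H : Finset α, 0 ≤ productWeight (thinning t G) H := fun H =>
    productWeight_nonneg (thinning_nonneg ht0 G) (thinning_le_one ht1 G) H
  have hmul : ∀ H : Finset α, κ * D < σ * (((H ∩ A).card : ℝ) - t * D) →
      1 ≤ Real.exp (x * ((H ∩ A).card : ℝ)) * Real.exp (-(x * t * D) - κ ^ 2 / 2 * D) := by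
    intro H hH
    rw [← Real.exp_add, Real.one_le_exp_iff]
    have h1 := mul_le_mul_of_nonneg_left hH.le (by linarith : 0 ≤ κ / 2)
    have h2 : κ / 2 * (σ * (((H ∩ A).card : ℝ) - t * D)) = x * (((H ∩ A).card : ℝ) - t * D) := by
      rw [hx]; ring
    rw [h2] at h1
    linarith
  calc _ ≤ ∑ H ∈ Finset.univ.filter (fun H : Finset α => κ * D <
        σ * (((H ∩ A).card : ℝ) - t * D)), productWeight (thinning t G) H *
          (Real.exp (x * ((H ∩ A).card : ℝ)) * Real.exp (-(x * t * D) - κ ^ 2 / 2 * D)) := by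
        refine Finset.sum_le_sum fun H hH => ?_
        exact le_mul_of_one_le_right (hw H) (hmul H (Finset.mem_filter.1 hH).2)
    _ ≤ ∑ H, productWeight (thinning t G) H *
          (Real.exp (x * ((H ∩ A).card : ℝ)) * Real.exp (-(x * t * D) - κ ^ 2 / 2 * D)) :=
        Finset.sum_le_sum_of_subset_of_nonneg (Finset.subset_univ _) fun H _ _ =>
          mul_nonneg (hw H) (by positivity)
    _ = (∑ H, productWeight (thinning t G) H * Real.exp (x * ((H ∩ A).card : ℝ))) *
          Real.exp (-(x * t * D) - κ ^ 2 / 2 * D) := by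
        rw [Finset.sum_mul]; exact Finset.sum_congr rfl fun H _ => by ring
    _ ≤ Real.exp (t * (Real.exp x - 1) * D) * Real.exp (-(x * t * D) - κ ^ 2 / 2 * D) :=
        mul_le_mul_of_nonneg_right (sum_productWeight_thinning_exp_le ht0 ht1 G A x)
          (Real.exp_pos _).le
    _ ≤ _ := by
        rw [← Real.exp_add, Real.exp_le_exp]
        have h3 : Real.exp x - 1 - x ≤ κ ^ 2 / 4 := by
          rw [← hx2]; linarith [exp_le_one_add_add_sq hxabs]
        have h4 : t * (Real.exp x - 1 - x) ≤ κ ^ 2 / 4 := by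
          refine (mul_le_mul_of_nonneg_left h3 ht0).trans ?_
          exact mul_le_of_le_one_left (by positivity) ht1
        nlinarith [mul_le_mul_of_nonneg_right h4 hD]

end Chernoff

/-! ### Typical thinnings and quantitative lower bounds for the arrival rates. -/

section Rates

variable {V : Type*} [Fintype V] [DecidableEq V]

/-- The degrees of `H` are close to a `t`-fraction of those prescribed by `d`. -/
def HasFraction (d : V → ℕ) (κ t : ℝ) (H : Finset (Sym2 V)) : Prop :=
  ∀ v, |(edgeDeg H v : ℝ) - t * d v| ≤ κ * d v

/-- A union bound over the vertices and the two signs of the deviation, applied to the edges at each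
vertex. -/
theorem sum_productWeight_not_hasFraction_le {d : V → ℕ} {G : Finset (Sym2 V)}
    (hG : G ∈ degreeFamily d) {t κ δ : ℝ} (ht0 : 0 ≤ t) (ht1 : t ≤ 1) (hκ0 : 0 ≤ κ) (hκ1 : κ ≤ 2)
    (hδ : ∀ v, δ ≤ d v) [DecidablePred (HasFraction d κ t)] :
    ∑ H ∈ Finset.univ.filter (fun H => ¬ HasFraction d κ t H), productWeight (thinning t G) H ≤
      2 * Fintype.card V * Real.exp (-(κ ^ 2 / 4 * δ)) := by
  have hw : ∀ H : Finset (Sym2 V), 0 ≤ productWeight (thinning t G) H := fun H =>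
    productWeight_nonneg (thinning_nonneg ht0 G) (thinning_le_one ht1 G) H
  let A : V → Finset (Sym2 V) := fun v => Finset.univ.filter fun e => v ∈ e
  have hA : ∀ H v, (H ∩ A v).card = edgeDeg H v := by
    intro H v
    unfold edgeDeg
    congr 1
    ext e
    simp [A]
  have hGA : ∀ v, ((G ∩ A v).card : ℝ) = d v := fun v => by
    rw [hA, (mem_degreeFamily.1 hG).2]
  have hone : ∀ v, ∀ σ : ℝ, σ ^ 2 = 1 →
      ∑ H ∈ Finset.univ.filter (fun H : Finset (Sym2 V) => κ * (d v : ℝ) <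
        σ * ((edgeDeg H v : ℝ) - t * d v)), productWeight (thinning t G) H ≤
      Real.exp (-(κ ^ 2 / 4 * δ)) := by
    intro v σ hσ
    have := sum_productWeight_thinning_filter_le ht0 ht1 G (A v) hκ0 hκ1 hσ
    rw [hGA] at this
    simp only [hA] at this
    refine this.trans (Real.exp_le_exp.2 ?_)
    have := mul_le_mul_of_nonneg_left (hδ v) (by positivity : 0 ≤ κ ^ 2 / 4)
    linarith
  have hpt : ∀ H, (if ¬ HasFraction d κ t H then productWeight (thinning t G) H else 0) ≤
      ∑ v, ((if κ * (d v : ℝ) < 1 * ((edgeDeg H v : ℝ) - t * d v) then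
          productWeight (thinning t G) H else 0) +
        if κ * (d v : ℝ) < (-1) * ((edgeDeg H v : ℝ) - t * d v) then
          productWeight (thinning t G) H else 0) := by
    intro H
    have hterm : ∀ v, 0 ≤ ((if κ * (d v : ℝ) < 1 * ((edgeDeg H v : ℝ) - t * d v) then
          productWeight (thinning t G) H else 0) +
        if κ * (d v : ℝ) < (-1) * ((edgeDeg H v : ℝ) - t * d v) then
          productWeight (thinning t G) H else 0) := fun v =>
      add_nonneg (by split_ifs; exacts [hw H, le_rfl]) (by split_ifs; exacts [hw H, le_rfl])
    by_cases hH : HasFraction d κ t H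
    · rw [if_neg (not_not.2 hH)]
      exact Finset.sum_nonneg fun v _ => hterm v
    · rw [if_pos hH]
      simp only [HasFraction, not_forall, not_le] at hH
      obtain ⟨v, hv⟩ := hH
      refine le_trans ?_ (Finset.single_le_sum (fun v _ => hterm v) (Finset.mem_univ v))
      rcases lt_abs.1 hv with h | h
      · rw [if_pos (by linarith)]
        exact le_add_of_nonneg_right (by split_ifs; exacts [hw H, le_rfl])
      · rw [if_pos (c := κ * (d v : ℝ) < (-1) * ((edgeDeg H v : ℝ) - t * d v)) (by linarith)]
        exact le_add_of_nonneg_left (by split_ifs; exacts [hw H, le_rfl])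
  rw [Finset.sum_filter]
  refine (Finset.sum_le_sum fun H _ => hpt H).trans ?_
  rw [Finset.sum_comm]
  simp only [Finset.sum_add_distrib, ← Finset.sum_filter]
  have h1 := Finset.sum_le_card_nsmul Finset.univ _ _ fun v _ => hone v 1 (by norm_num)
  have h2 := Finset.sum_le_card_nsmul Finset.univ _ _ fun v _ => hone v (-1) (by norm_num)
  rw [nsmul_eq_mul, Finset.card_univ] at h1 h2
  linarith

/-- Degree sequences with all degrees large and the squares of all degrees small compared to the
sum, quantitatively in terms of `γ`. -/
structure IsModerate (d : V → ℕ) (Δ : ℕ) (γ : ℝ) : Prop where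
  pos : 0 < γ
  le_half : γ ≤ 1 / 2
  one_le : 1 ≤ Δ
  deg_le : ∀ v, d v ≤ Δ
  le_deg : ∀ v, 20 ≤ γ ^ 2 * d v
  sq_le : 200 * (Δ : ℝ) ^ 2 ≤ γ ^ 3 * (∑ v, d v : ℕ)
  even : Even (∑ v, d v)

namespace IsModerate

variable {d : V → ℕ} {Δ : ℕ} {γ : ℝ}

omit [DecidableEq V] in
theorem sum_pos (h : IsModerate d Δ γ) : 0 < ((∑ v, d v : ℕ) : ℝ) := by
  have h1 := h.sq_le
  have h2 : (1 : ℝ) ≤ Δ := by exact_mod_cast h.one_le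
  by_contra hM
  have h3 := mul_nonpos_of_nonneg_of_nonpos (pow_nonneg h.pos.le 3) (not_lt.1 hM)
  nlinarith

omit [DecidableEq V] in
theorem sq_le_mul (h : IsModerate d Δ γ) : 50 * (Δ : ℝ) ^ 2 ≤ γ ^ 2 * (∑ v, d v : ℕ) * (1 / 8) ∧
    100 * (Δ : ℝ) ^ 2 ≤ γ * (∑ v, d v : ℕ) / 4 := by
  have h1 := h.sq_le
  have h2 := h.sum_pos
  have h3 := h.pos
  have h4 := h.le_half
  have h5 : γ ^ 3 * ((∑ v, d v : ℕ) : ℝ) ≤ γ ^ 2 * (1 / 2) * (∑ v, d v : ℕ) := by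
    refine mul_le_mul_of_nonneg_right ?_ h2.le
    rw [pow_succ]
    exact mul_le_mul_of_nonneg_left h4 (by positivity)
  have h6 : γ ^ 2 * (1 / 2) * ((∑ v, d v : ℕ) : ℝ) ≤ γ * (1 / 2) * (1 / 2) * (∑ v, d v : ℕ) := by
    refine mul_le_mul_of_nonneg_right ?_ h2.le
    nlinarith
  constructor <;> nlinarith [mul_pos h3 h2]

omit [DecidableEq V] in
-- The loss to forbidden switchings, including the 4 for revealed edges, is only a γ/10 fraction of
-- the degree sum.
theorem switch_le (h : IsModerate d Δ γ) :
    2 * ((Δ : ℝ) * (Δ + 1)) + 4 ≤ γ * (∑ v, d v : ℕ) / 10 := by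
  have h1 := h.sq_le_mul.2
  have h2 : (1 : ℝ) ≤ Δ := by exact_mod_cast h.one_le
  nlinarith

theorem nonempty (h : IsModerate d Δ γ) : (degreeFamily d).Nonempty := by
  refine degreeFamily_nonempty h.deg_le h.even ?_
  have h1 := h.switch_le
  have h2 := h.le_half
  have h3 := h.sum_pos
  have : (3 * ((Δ : ℝ) * (Δ + 1))) < (∑ v, d v : ℕ) := by nlinarith
  exact_mod_cast this

/-- Conditionally on a typical partial graph `H`, each further edge is present with at least the
expected probability. -/
theorem mul_extCount_le_extCount_insert (h : IsModerate d Δ γ) {t : ℝ} (ht0 : 0 ≤ t)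
    (ht1 : t ≤ 1 - γ) {H : Finset (Sym2 V)} (hH : HasFraction d (γ ^ 2 / 10) t H) {j k : V}
    (hjk : j ≠ k) (hjkH : s(j, k) ∉ H) :
    (1 - t) * ((1 - γ) * (d j * d k / (∑ v, d v : ℕ))) * extCount (degreeFamily d) H ≤
      extCount (degreeFamily d) (insert s(j, k) H) := by
  have hγ := h.pos
  have hγ2 := h.le_half
  have hM := h.sum_pos
  set M : ℝ := ((∑ v, d v : ℕ) : ℝ) with hMdef
  set N : ℝ := (extCount (degreeFamily d) H : ℝ)
  set N₁ : ℝ := (extCount (degreeFamily d) (insert s(j, k) H) : ℝ)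
  have hN : 0 ≤ N := Nat.cast_nonneg _
  have hN₁ : 0 ≤ N₁ := Nat.cast_nonneg _
  set s : ℝ := 1 - t with hs
  have hsγ : γ ≤ s := by linarith
  have hs1 : s ≤ 1 := by linarith
  -- Residual degrees are about `s * d v` with `s ≥ γ`, so an error of γ²/10 times `d v` is a
  -- relative error of at most γ/10.
  have hκs : γ ^ 2 / 10 ≤ s * (γ / 10) := by nlinarith
  have hdeg : ∀ v, (edgeDeg H v : ℝ) ≤ d v := by
    intro v
    have h1 := (abs_le.1 (hH v)).2
    have h2 : (0 : ℝ) ≤ d v := Nat.cast_nonneg _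
    have h3 : (t + γ ^ 2 / 10) * d v ≤ 1 * d v :=
      mul_le_mul_of_nonneg_right (by nlinarith) h2
    linarith
  have hres : ∀ v, (residualDeg d H v : ℝ) = d v - edgeDeg H v := by
    intro v
    exact Nat.cast_sub (by exact_mod_cast hdeg v)
  have hlow : ∀ v, s * (1 - γ / 10) * d v ≤ residualDeg d H v := by
    intro v
    have h1 := (abs_le.1 (hH v)).2
    have h2 := mul_le_mul_of_nonneg_right hκs (Nat.cast_nonneg (α := ℝ) (d v))
    rw [hres]
    have : t = 1 - s := by rw [hs]; ring
    rw [this] at h1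
    linarith
  have hup : ∀ v, (residualDeg d H v : ℝ) ≤ s * (1 + γ / 10) * d v := by
    intro v
    have h1 := (abs_le.1 (hH v)).1
    have h2 := mul_le_mul_of_nonneg_right hκs (Nat.cast_nonneg (α := ℝ) (d v))
    rw [hres]
    have : t = 1 - s := by rw [hs]; ring
    rw [this] at h1
    linarith
  set M' : ℝ := ((∑ v, residualDeg d H v : ℕ) : ℝ) with hM'
  have hM'low : s * (1 - γ / 10) * M ≤ M' := by
    rw [hM', hMdef, Nat.cast_sum, Nat.cast_sum, Finset.mul_sum]
    exact Finset.sum_le_sum fun v _ => hlow v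
  have hM'up : M' ≤ s * (1 + γ / 10) * M := by
    rw [hM', hMdef, Nat.cast_sum, Nat.cast_sum, Finset.mul_sum]
    exact Finset.sum_le_sum fun v _ => hup v
  set a : ℝ := (residualDeg d H j : ℝ)
  set b : ℝ := (residualDeg d H k : ℝ)
  have ha0 : 0 ≤ a := Nat.cast_nonneg _
  have hb0 : 0 ≤ b := Nat.cast_nonneg _
  -- The residual total is at least 9γM/10 and the forbidden switchings cost at most γM/10, so γM/4
  -- leaves ample room.
  have hX : γ * M / 4 + 2 * ((Δ : ℝ) * (Δ + 1)) + 4 ≤ M' := by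
    have h1 := h.switch_le
    have h2 : γ * (9 / 10) * M ≤ s * (1 - γ / 10) * M := by
      refine mul_le_mul_of_nonneg_right ?_ hM.le
      exact mul_le_mul hsγ (by linarith) (by norm_num) (by linarith)
    have := mul_pos hγ hM
    linarith
  have hmain := mul_extCount_le (X := γ * M / 4) h.deg_le hjk hjkH (by positivity) hX
  change a * b * N ≤ (M' + a * b) * N₁ + a * N + a * b * ((Δ : ℝ) ^ 2 * M / (γ * M / 4) ^ 2) * N
    at hmain
  -- Three errors are each reduced to a relative γ/10: paths whose ends are joined (`hq`), the
  -- product `a * b` beside `M'` (`hab`), and coinciding ends (`hb`, where large minimum degree is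
  -- needed).
  have hq : (Δ : ℝ) ^ 2 * M / (γ * M / 4) ^ 2 ≤ γ / 10 := by
    rw [div_le_iff₀ (by positivity)]
    have h1 := mul_le_mul_of_nonneg_right h.sq_le hM.le
    have h2 : 0 ≤ γ ^ 3 * M * M := by positivity
    linear_combination h1 / 200 + h2 / 800
  have hab : a * b ≤ s * (γ / 10) * M := by
    have h1 : a ≤ Δ := by exact Nat.cast_le.2 ((Nat.sub_le _ _).trans (h.deg_le j))
    have h2 : b ≤ Δ := by exact Nat.cast_le.2 ((Nat.sub_le _ _).trans (h.deg_le k))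
    have h3 : a * b ≤ (Δ : ℝ) ^ 2 := by
      rw [pow_two]; exact mul_le_mul h1 h2 hb0 (Nat.cast_nonneg _)
    have h4 := h.sq_le_mul.1
    have h5 : γ ^ 2 / 10 * M ≤ s * (γ / 10) * M := mul_le_mul_of_nonneg_right hκs hM.le
    have : 0 ≤ γ ^ 2 * M := by positivity
    linarith
  have hb : 1 ≤ γ / 10 * b := by
    have h1 := h.le_deg k
    have h2 := hlow k
    have h3 : γ * (1 / 2) * d k ≤ s * (1 - γ / 10) * d k := by
      refine mul_le_mul_of_nonneg_right ?_ (Nat.cast_nonneg _)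
      exact mul_le_mul hsγ (by linarith) (by norm_num) (by linarith)
    nlinarith
  have h1 : a * b * (1 - γ / 5) * N ≤ s * (1 + γ / 5) * M * N₁ := by
    have e1 : a * N ≤ a * b * (γ / 10) * N := by
      have := mul_le_mul_of_nonneg_left hb (mul_nonneg ha0 hN)
      linarith
    have e2 : a * b * ((Δ : ℝ) ^ 2 * M / (γ * M / 4) ^ 2) * N ≤ a * b * (γ / 10) * N :=
      mul_le_mul_of_nonneg_right (mul_le_mul_of_nonneg_left hq (mul_nonneg ha0 hb0)) hN
    have e3 : (M' + a * b) * N₁ ≤ s * (1 + γ / 5) * M * N₁ := by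
      refine mul_le_mul_of_nonneg_right ?_ hN₁
      linarith
    linarith
  have hs0 : 0 < s := hγ.trans_le hsγ
  have h2 : (s * (1 - γ / 10) * d j) * (s * (1 - γ / 10) * d k) ≤ a * b :=
    mul_le_mul (hlow j) (hlow k) (mul_nonneg (mul_nonneg hs0.le (by linarith)) (Nat.cast_nonneg _))
      ha0
  have h3 : (s * (1 - γ / 10) * d j) * (s * (1 - γ / 10) * d k) * (1 - γ / 5) * N ≤
      s * (1 + γ / 5) * M * N₁ :=
    (mul_le_mul_of_nonneg_right (mul_le_mul_of_nonneg_right h2 (by linarith)) hN).trans h1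
  set y : ℝ := s * d j * d k * N with hy
  have hy0 : 0 ≤ y := by positivity
  -- The residual degrees of `j` and `k` bring two factors `s`, the residual total one; cancelling
  -- leaves the factor `s = 1 - t` of the claim.
  have h4 : (1 - γ / 10) ^ 2 * (1 - γ / 5) * y ≤ (1 + γ / 5) * (M * N₁) := by
    refine le_of_mul_le_mul_left (a := s) ?_ hs0
    rw [hy]
    linarith
  have h5 : (1 - γ) * (1 + γ / 5) ≤ (1 - γ / 10) ^ 2 * (1 - γ / 5) := by nlinarith
  have h6 : (1 - γ) * y ≤ M * N₁ := by
    refine le_of_mul_le_mul_left (a := 1 + γ / 5) ?_ (by linarith)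
    have := mul_le_mul_of_nonneg_right h5 hy0
    linarith
  have h7 : s * ((1 - γ) * (d j * d k / M)) * N = (1 - γ) * y / M := by
    rw [hy]; ring
  rw [h7, div_le_iff₀ hM]
  linarith

omit [Fintype V] in
theorem hasFraction_empty (d : V → ℕ) {κ : ℝ} (hκ : 0 ≤ κ) : HasFraction d κ 0 ∅ := by
  intro v
  simp only [edgeDeg, Finset.filter_empty, Finset.card_empty, Nat.cast_zero, zero_mul, sub_zero,
    abs_zero]
  positivity

/-- Two-sided estimate of the unconditional edge probabilities. -/
theorem extCount_singleton_bounds (h : IsModerate d Δ γ) {j k : V} (hjk : j ≠ k) :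
    (1 - γ) * (d j * d k / (∑ v, d v : ℕ)) * (degreeFamily d).card ≤
      extCount (degreeFamily d) {s(j, k)} ∧
    (1 - γ) * extCount (degreeFamily d) {s(j, k)} ≤
      (d j * d k / (∑ v, d v : ℕ) : ℝ) * (degreeFamily d).card := by
  have hempty : extCount (degreeFamily d) ∅ = (degreeFamily d).card := by
    simp [extCount]
  have hM := h.sum_pos
  constructor
  · have := h.mul_extCount_le_extCount_insert le_rfl (by linarith [h.le_half])
      (hasFraction_empty d (by positivity)) hjk (Finset.notMem_empty _)
    rw [hempty] at this
    simpa using this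
  · have hres : ∀ v, residualDeg d ∅ v = d v := fun v => by simp [residualDeg, edgeDeg]
    have h1 := extCount_insert_mul_le_of_le h.deg_le hjk (Finset.notMem_empty _)
      (X := (1 - γ) * (∑ v, d v : ℕ)) (by
        simp only [hres]
        have := h.switch_le
        have := mul_pos h.pos hM
        linarith)
    rw [hempty, hres, hres] at h1
    rw [div_mul_eq_mul_div, le_div_iff₀ hM]
    simp only [insert_empty_eq] at h1
    linarith

end IsModerate

end Rates

/-! ### Finite measures given by point masses. -/

section Measures

variable {X : Type*} [Fintype X] [MeasurableSpace X] [DiscreteMeasurableSpace X]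

open Classical in
theorem sum_ofReal_smul_dirac_apply {w : X → ℝ} (hw : ∀ x, 0 ≤ w x) (S : Set X) :
    (Measure.sum fun x => ENNReal.ofReal (w x) • Measure.dirac x) S =
      ENNReal.ofReal (∑ x ∈ Finset.univ.filter (fun x => x ∈ S), w x) := by
  rw [Measure.sum_apply _ (MeasurableSet.of_discrete), tsum_fintype,
    ENNReal.ofReal_sum_of_nonneg fun x _ => hw x, Finset.sum_filter]
  refine Finset.sum_congr rfl fun x _ => ?_
  by_cases hx : x ∈ S <;> simp [hx]

variable {Y : Type*} [Fintype Y] [MeasurableSpace Y] [DiscreteMeasurableSpace Y]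

theorem isCoupling_of_marginals {J : X → Y → ℝ} {μ : X → ℝ} {ν : Y → ℝ}
    (hJ : ∀ x y, 0 ≤ J x y) (hμ : ∀ x, ∑ y, J x y = μ x) (hν : ∀ y, ∑ x, J x y = ν y)
    (hone : ∑ x, μ x = 1) :
    IsCoupling (Measure.sum fun p : X × Y => ENNReal.ofReal (J p.1 p.2) • Measure.dirac p)
      (Measure.sum fun x => ENNReal.ofReal (μ x) • Measure.dirac x)
      (Measure.sum fun y => ENNReal.ofReal (ν y) • Measure.dirac y) := by
  classical
  have hJ' : ∀ p : X × Y, 0 ≤ J p.1 p.2 := fun p => hJ _ _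
  have hμ0 : ∀ x, 0 ≤ μ x := fun x => hμ x ▸ Finset.sum_nonneg fun y _ => hJ x y
  have hν0 : ∀ y, 0 ≤ ν y := fun y => hν y ▸ Finset.sum_nonneg fun x _ => hJ x y
  refine ⟨⟨?_⟩, ?_, ?_⟩
  · rw [sum_ofReal_smul_dirac_apply hJ']
    simp [Fintype.sum_prod_type, hμ, hone]
  · ext S hS
    rw [Measure.map_apply measurable_fst hS, sum_ofReal_smul_dirac_apply hJ',
      sum_ofReal_smul_dirac_apply hμ0]
    congr 1
    rw [Finset.sum_filter, Finset.sum_filter, Fintype.sum_prod_type]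
    refine Finset.sum_congr rfl fun x _ => ?_
    by_cases hx : x ∈ S <;> simp [hx, hμ]
  · ext S hS
    rw [Measure.map_apply measurable_snd hS, sum_ofReal_smul_dirac_apply hJ',
      sum_ofReal_smul_dirac_apply hν0]
    congr 1
    rw [Finset.sum_filter, Finset.sum_filter, Fintype.sum_prod_type, Finset.sum_comm]
    refine Finset.sum_congr rfl fun x _ => ?_
    by_cases hx : x ∈ S <;> simp [hx, hν]

end Measures

/-! ### Translation between graphs and edge sets. -/

section Graphs

variable {n : ℕ}

/-- A graph is determined by finitely many measurable adjacency relations, so on this finite type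
every set is measurable. -/
instance : MeasurableSingletonClass (SimpleGraph (Fin n)) where
  measurableSet_singleton G := by
    have : ({G} : Set (SimpleGraph (Fin n))) =
        ⋂ u, ⋂ v, (fun G' : SimpleGraph (Fin n) => G'.Adj u v) ⁻¹' {G.Adj u v} := by
      ext G'
      simp [SimpleGraph.ext_iff, funext_iff]
    rw [this]
    refine MeasurableSet.iInter fun u => MeasurableSet.iInter fun v => ?_
    have hm : Measurable fun G' : SimpleGraph (Fin n) => G'.Adj u v :=
      SimpleGraph.measurable_iff_adj.1 measurable_id u v
    exact hm (MeasurableSet.singleton _)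

open Classical in
-- `Sym2` also contains the diagonal pairs; with zero diagonal in `W` they contribute factors 1.
theorem inhomogeneousWeight_eq_productWeight {W : Matrix (Fin n) (Fin n) ℝ}
    {w : Sym2 (Fin n) → ℝ} (hW : ∀ j k, w s(j, k) = W j k) (hdiag : ∀ j, W j j = 0)
    (G : SimpleGraph (Fin n)) : inhomogeneousWeight W G = productWeight w G.edgeFinset := by
  have h1 : productWeight w G.edgeFinset = ∏ e ∈ Finset.univ.filter (fun e => ¬ e.IsDiag),
      if e ∈ G.edgeFinset then w e else 1 - w e := by
    symm
    refine Finset.prod_subset (Finset.subset_univ _) fun e _ he => ?_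
    simp only [Finset.mem_filter, Finset.mem_univ, true_and, not_not] at he
    induction e using Sym2.inductionOn with
    | hf x y =>
      obtain rfl : x = y := by simpa using he
      simp [hW, hdiag]
  rw [h1, inhomogeneousWeight, Finset.prod_sigma']
  refine Finset.prod_nbij (fun x => s(x.1, x.2)) ?_ ?_ ?_ ?_
  · rintro ⟨j, k⟩ hx
    simp only [Finset.mem_sigma, Finset.mem_univ, Finset.mem_Ioi, true_and] at hx
    simpa using hx.ne
  · rintro ⟨j, k⟩ hx ⟨j', k'⟩ hx' heq
    simp only [Finset.coe_sigma, Set.mem_sigma_iff, Finset.mem_coe, Finset.mem_univ,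
      Finset.mem_Ioi, true_and] at hx hx'
    rcases Sym2.eq_iff.1 heq with ⟨h1, h2⟩ | ⟨h1, h2⟩
    · dsimp only at h1 h2; subst h1 h2; rfl
    · dsimp only at h1 h2; subst h1 h2; exact absurd hx (lt_asymm hx')
  · intro e he
    simp only [Finset.coe_filter, Finset.mem_univ, true_and, Set.mem_ofPred_eq] at he
    induction e using Sym2.inductionOn with
    | hf x y =>
      have hxy : x ≠ y := by simpa using he
      rcases lt_or_gt_of_ne hxy with h | h
      · exact ⟨⟨x, y⟩, by simpa using h, rfl⟩
      · exact ⟨⟨y, x⟩, by simpa using h, Sym2.eq_swap⟩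
  · rintro ⟨j, k⟩ -
    simp [hW]

open Classical in
-- Sets containing a diagonal pair have weight zero; the remaining ones correspond bijectively to
-- graphs.
theorem sum_productWeight_mul_fromEdgeSet {W : Matrix (Fin n) (Fin n) ℝ}
    {w : Sym2 (Fin n) → ℝ} (hW : ∀ j k, w s(j, k) = W j k) (hdiag : ∀ j, W j j = 0)
    (φ : SimpleGraph (Fin n) → ℝ) :
    ∑ R : Finset (Sym2 (Fin n)), productWeight w R * φ (SimpleGraph.fromEdgeSet (R : Set _)) =
      ∑ G, inhomogeneousWeight W G * φ G := by
  symm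
  rw [← Finset.sum_subset (Finset.subset_univ
    (Finset.univ.filter fun R : Finset (Sym2 (Fin n)) => ∀ e ∈ R, ¬ e.IsDiag))]
  · refine Finset.sum_nbij' (fun G => G.edgeFinset)
      (fun R => SimpleGraph.fromEdgeSet (R : Set (Sym2 (Fin n)))) ?_ ?_ ?_ ?_ ?_
    · intro G _
      simp only [Finset.mem_filter, Finset.mem_univ, true_and]
      intro e he
      exact G.not_isDiag_of_mem_edgeFinset he
    · simp
    · intro G _
      simp
    · intro R hR
      simp only [Finset.mem_filter, Finset.mem_univ, true_and] at hR
      ext e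
      simp only [SimpleGraph.mem_edgeFinset, SimpleGraph.edgeSet_fromEdgeSet, Set.mem_sdiff,
        Finset.mem_coe]
      exact ⟨fun h => h.1, fun h => ⟨h, hR e h⟩⟩
    · intro G _
      rw [inhomogeneousWeight_eq_productWeight hW hdiag]
      simp
  · intro R _ hR
    simp only [Finset.mem_filter, Finset.mem_univ, true_and, not_forall, not_not] at hR
    obtain ⟨e, he, hd⟩ := hR
    rw [productWeight_eq_zero he, zero_mul]
    induction e using Sym2.inductionOn with
    | hf x y =>
      obtain rfl : x = y := by simpa using hd
      rw [hW, hdiag]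

open Classical in
theorem edgeFinset_mem_degreeFamily {d : Fin n → ℕ} {G : SimpleGraph (Fin n)} :
    G.edgeFinset ∈ degreeFamily d ↔ G ∈ graphsWithDegrees d := by
  have h1 : ∀ v, edgeDeg G.edgeFinset v = (G.neighborSet v).ncard := by
    intro v
    rw [← card_filter_mk_mem, Set.ncard_eq_toFinset_card']
    congr 1
    ext a
    simp
  rw [mem_degreeFamily, graphsWithDegrees, Set.mem_ofPred_eq]
  simp only [h1]
  exact ⟨fun h => h.2, fun h => ⟨fun e he => G.not_isDiag_of_mem_edgeFinset he, h⟩⟩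

open Classical in
theorem sum_degreeFamily_fromEdgeSet (d : Fin n → ℕ) (φ : SimpleGraph (Fin n) → ℝ) :
    ∑ R ∈ degreeFamily d, φ (SimpleGraph.fromEdgeSet (R : Set (Sym2 (Fin n)))) =
      ∑ G ∈ Finset.univ.filter (fun G => G ∈ graphsWithDegrees d), φ G := by
  symm
  refine Finset.sum_nbij' (fun G => G.edgeFinset)
      (fun R => SimpleGraph.fromEdgeSet (R : Set (Sym2 (Fin n)))) ?_ ?_ ?_ ?_ ?_
  · intro G hG
    exact edgeFinset_mem_degreeFamily.2 (Finset.mem_filter.1 hG).2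
  · intro R hR
    refine Finset.mem_filter.2 ⟨Finset.mem_univ _, edgeFinset_mem_degreeFamily.1 ?_⟩
    convert hR
    ext e
    simp only [SimpleGraph.mem_edgeFinset, SimpleGraph.edgeSet_fromEdgeSet, Set.mem_sdiff,
      Finset.mem_coe]
    exact ⟨fun h => h.1, fun h => ⟨h, (mem_degreeFamily.1 hR).1 e h⟩⟩
  · intro G _
    simp
  · intro R hR
    ext e
    simp only [SimpleGraph.mem_edgeFinset, SimpleGraph.edgeSet_fromEdgeSet, Set.mem_sdiff,
      Finset.mem_coe]
    exact ⟨fun h => h.1, fun h => ⟨h, (mem_degreeFamily.1 hR).1 e h⟩⟩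
  · intro G _
    simp

open Classical in
/-- The probability mass function of `𝒢(n, d)`. -/
noncomputable def degreeWeight (d : Fin n → ℕ) (G : SimpleGraph (Fin n)) : ℝ :=
  if G ∈ graphsWithDegrees d then ((degreeFamily d).card : ℝ)⁻¹ else 0

theorem degreeWeight_nonneg (d : Fin n → ℕ) (G : SimpleGraph (Fin n)) : 0 ≤ degreeWeight d G := by
  unfold degreeWeight
  split_ifs
  exacts [inv_nonneg.2 (Nat.cast_nonneg _), le_rfl]

open Classical in
theorem sum_degreeWeight_mul (d : Fin n → ℕ) (φ : SimpleGraph (Fin n) → ℝ) :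
    ∑ G, degreeWeight d G * φ G = ((degreeFamily d).card : ℝ)⁻¹ *
      ∑ R ∈ degreeFamily d, φ (SimpleGraph.fromEdgeSet (R : Set (Sym2 (Fin n)))) := by
  rw [sum_degreeFamily_fromEdgeSet, Finset.mul_sum, Finset.sum_filter]
  refine Finset.sum_congr rfl fun G _ => ?_
  unfold degreeWeight
  split_ifs <;> simp

open Classical in
theorem card_filter_graphsWithDegrees (d : Fin n → ℕ) :
    (Finset.univ.filter (fun G => G ∈ graphsWithDegrees d)).card = (degreeFamily d).card := by
  have := sum_degreeFamily_fromEdgeSet d fun _ => 1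
  simp only [Finset.sum_const, nsmul_eq_mul, mul_one] at this
  exact_mod_cast this.symm

theorem degreeGraph_eq_sum {d : Fin n → ℕ} (hd : (degreeFamily d).Nonempty) :
    degreeGraph d =
      Measure.sum fun G => ENNReal.ofReal (degreeWeight d G) • Measure.dirac G := by
  classical
  have hpos : 0 < (degreeFamily d).card := Finset.card_pos.2 hd
  ext S _
  rw [sum_ofReal_smul_dirac_apply (degreeWeight_nonneg d), degreeGraph]
  have h1 : graphsWithDegrees d =
      ((Finset.univ.filter fun G => G ∈ graphsWithDegrees d : Finset _) : Set _) := by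
    ext; simp
  have h2 : S = ((Finset.univ.filter fun G => G ∈ S : Finset _) : Set _) := by
    ext; simp
  rw [h1]
  nth_rw 1 [h2]
  rw [ProbabilityTheory.uniformOn_apply_finset, card_filter_graphsWithDegrees]
  unfold degreeWeight
  rw [← Finset.sum_filter, Finset.sum_const, nsmul_eq_mul, Finset.filter_filter,
    ← Finset.filter_and, ← div_eq_mul_inv, ENNReal.ofReal_div_of_pos (by exact_mod_cast hpos),
    ENNReal.ofReal_natCast, ENNReal.ofReal_natCast]
  simp only [and_comm]

theorem sum_degreeWeight {d : Fin n → ℕ} (hd : (degreeFamily d).Nonempty) :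
    ∑ G, degreeWeight d G = 1 := by
  have := sum_degreeWeight_mul d fun _ => 1
  have hpos : ((degreeFamily d).card : ℝ) ≠ 0 := by
    exact_mod_cast (Finset.card_pos.2 hd).ne'
  simpa [hpos] using this

theorem degreeGraph_real_adj {d : Fin n → ℕ} (hd : (degreeFamily d).Nonempty) {j k : Fin n}
    (hjk : j ≠ k) :
    (degreeGraph d).real {G | G.Adj j k} =
      extCount (degreeFamily d) {s(j, k)} / (degreeFamily d).card := by
  classical
  rw [Measure.real, degreeGraph_eq_sum hd, sum_ofReal_smul_dirac_apply (degreeWeight_nonneg d),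
    ENNReal.toReal_ofReal (Finset.sum_nonneg fun G _ => degreeWeight_nonneg d G)]
  have := sum_degreeWeight_mul d fun G => if G.Adj j k then 1 else 0
  simp only [mul_ite, mul_one, mul_zero] at this
  rw [Finset.sum_filter]
  simp only [Set.mem_ofPred_eq]
  rw [this, div_eq_inv_mul, extCount]
  simp [hjk]

end Graphs

/-! ### The embedding for a fixed precision γ. -/

section Embedding

variable {n : ℕ}

/-- The rate at which the edges of the embedded graph appear. -/
noncomputable def edgeRate (d : Fin n → ℕ) (γ : ℝ) : Sym2 (Fin n) → ℝ :=
  Sym2.lift ⟨fun j k => if j = k then 0 else (1 - γ) * ((d j * d k : ℝ) / total d), fun j k => by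
    simp only [eq_comm (a := j), mul_comm (d j : ℝ)]⟩

/-- The edge probabilities of the embedded graph. -/
noncomputable def embeddingProb (d : Fin n → ℕ) (γ : ℝ) (e : Sym2 (Fin n)) : ℝ :=
  1 - Real.exp (-(edgeRate d γ e * (1 - γ)))

/-- The matrix of the embedded graph. -/
noncomputable def embeddingMatrix (d : Fin n → ℕ) (γ : ℝ) : Matrix (Fin n) (Fin n) ℝ :=
  Matrix.of fun j k => embeddingProb d γ s(j, k)

namespace IsModerate

variable {d : Fin n → ℕ} {Δ : ℕ} {γ : ℝ}

theorem div_total_le (h : IsModerate d Δ γ) (j k : Fin n) : (d j * d k : ℝ) / total d ≤ γ := by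
  have hM : 0 < (total d : ℝ) := h.sum_pos
  rw [div_le_iff₀ hM]
  have h1 : (d j : ℝ) ≤ Δ := by exact_mod_cast h.deg_le j
  have h2 : (d k : ℝ) ≤ Δ := by exact_mod_cast h.deg_le k
  have h3 : (d j * d k : ℝ) ≤ Δ ^ 2 := by
    rw [pow_two]; exact mul_le_mul h1 h2 (Nat.cast_nonneg _) (Nat.cast_nonneg _)
  have h4 : 100 * (Δ : ℝ) ^ 2 ≤ γ * total d / 4 := h.sq_le_mul.2
  have := mul_pos h.pos hM
  linarith

theorem edgeMatrix_eq (h : IsModerate d Δ γ) {j k : Fin n} (hjk : j ≠ k) :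
    edgeMatrix d j k = ((d j * d k : ℝ) / total d) / (1 + (d j * d k : ℝ) / total d) := by
  have hM : 0 < (total d : ℝ) := h.sum_pos
  simp only [edgeMatrix, Matrix.of_apply, if_neg hjk]
  have : 0 ≤ (d j * d k : ℝ) := by positivity
  field_simp

theorem edgeRate_nonneg (h : IsModerate d Δ γ) (e : Sym2 (Fin n)) : 0 ≤ edgeRate d γ e := by
  induction e using Sym2.inductionOn with
  | hf j k =>
    simp only [edgeRate, Sym2.lift_mk]
    split_ifs
    · exact le_rfl
    · exact mul_nonneg (by linarith [h.le_half]) (by positivity)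

theorem edgeRate_le_one (h : IsModerate d Δ γ) (e : Sym2 (Fin n)) : edgeRate d γ e ≤ 1 := by
  induction e using Sym2.inductionOn with
  | hf j k =>
    simp only [edgeRate, Sym2.lift_mk]
    split_ifs
    · exact zero_le_one
    · have h1 := h.div_total_le j k
      have h2 := h.pos
      have h3 := h.le_half
      have h4 : 0 ≤ (d j * d k : ℝ) / total d := by positivity
      nlinarith

theorem embeddingProb_nonneg (h : IsModerate d Δ γ) (e : Sym2 (Fin n)) :
    0 ≤ embeddingProb d γ e := by
  have h1 : Real.exp (-(edgeRate d γ e * (1 - γ))) ≤ 1 := Real.exp_le_one_iff.2 (by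
    have := mul_nonneg (h.edgeRate_nonneg e) (by linarith [h.le_half] : 0 ≤ 1 - γ)
    linarith)
  unfold embeddingProb
  linarith

theorem embeddingProb_le_one (d : Fin n → ℕ) (γ : ℝ) (e : Sym2 (Fin n)) :
    embeddingProb d γ e ≤ 1 := by
  unfold embeddingProb
  linarith [Real.exp_pos (-(edgeRate d γ e * (1 - γ)))]

/-- Put x = d_j d_k / M ≤ γ and z = (1 - γ)² x, one factor 1 - γ coming from the rate and one from
the stopping time. Then z - z² ≤ 1 - exp(-z) ≤ z. Above, (1 - γ)²(1 + x) ≤ 1 absorbs the denominator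
of P(d); below, 1 - z ≥ 1 - γ gives a third factor, and (1 - γ)³ ≥ 1 - 3γ. -/
theorem embeddingMatrix_bounds (h : IsModerate d Δ γ) (j k : Fin n) :
    (1 - 3 * γ) * edgeMatrix d j k ≤ embeddingMatrix d γ j k ∧
      embeddingMatrix d γ j k ≤ edgeMatrix d j k := by
  by_cases hjk : j = k
  · simp [edgeMatrix, embeddingMatrix, embeddingProb, edgeRate, hjk]
  rw [h.edgeMatrix_eq hjk]
  have hγ := h.pos
  have hγ2 := h.le_half
  have hxγ := h.div_total_le j k
  simp only [embeddingMatrix, embeddingProb, edgeRate, Matrix.of_apply, Sym2.lift_mk, if_neg hjk]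
  set x : ℝ := (d j * d k : ℝ) / total d
  have hx0 : 0 ≤ x := by positivity
  have hz : (1 - γ) * x * (1 - γ) = (1 - γ) ^ 2 * x := by ring
  rw [hz]
  set z : ℝ := (1 - γ) ^ 2 * x with hzdef
  have hz0 : 0 ≤ z := by positivity
  have hzx : z ≤ x := mul_le_of_le_one_left hx0 (by nlinarith)
  have hP : x / (1 + x) ≤ x := div_le_self hx0 (by linarith)
  have hP0 : 0 ≤ x / (1 + x) := by positivity
  constructor
  · have h1 := exp_le_one_add_add_sq (x := -z) (by rw [abs_neg, abs_of_nonneg hz0]; linarith)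
    have h2 : (1 - γ) ^ 3 * x ≤ z - z ^ 2 := by
      have : z * (1 - γ) ≤ z * (1 - z) := mul_le_mul_of_nonneg_left (by linarith) hz0
      rw [hzdef] at this ⊢
      linarith
    have h3 : (1 - 3 * γ) * (x / (1 + x)) ≤ (1 - γ) ^ 3 * (x / (1 + x)) :=
      mul_le_mul_of_nonneg_right (by nlinarith [pow_pos hγ 2]) hP0
    have h4 : (1 - γ) ^ 3 * (x / (1 + x)) ≤ (1 - γ) ^ 3 * x :=
      mul_le_mul_of_nonneg_left hP (pow_nonneg (by linarith) 3)
    linarith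
  · have h1 := Real.add_one_le_exp (-z)
    have h2 : z ≤ x / (1 + x) := by
      rw [le_div_iff₀ (by linarith)]
      have : (1 - γ) ^ 2 * (1 + x) ≤ 1 := by nlinarith
      rw [hzdef]
      nlinarith
    linarith

theorem card_eq (d : Fin n → ℕ) : ∀ G ∈ degreeFamily d, G.card = (∑ v, d v) / 2 := by
  intro G hG
  have h1 := sum_edgeDeg (mem_degreeFamily.1 hG).1
  simp only [(mem_degreeFamily.1 hG).2] at h1
  omega

theorem sum_edgeRate_le (h : IsModerate d Δ γ) : ∑ e, edgeRate d γ e ≤ (n : ℝ) ^ 2 := by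
  have h1 := Finset.sum_le_card_nsmul Finset.univ (edgeRate d γ) 1 fun e _ => h.edgeRate_le_one e
  have h2 : Fintype.card (Sym2 (Fin n)) ≤ Fintype.card (Fin n × Fin n) :=
    Fintype.card_le_of_surjective (fun p => s(p.1, p.2)) fun e => by
      induction e using Sym2.inductionOn with
      | hf j k => exact ⟨(j, k), rfl⟩
  rw [Fintype.card_prod, Fintype.card_fin] at h2
  have h3 : (Fintype.card (Sym2 (Fin n)) : ℝ) ≤ n * n := by exact_mod_cast h2
  rw [nsmul_eq_mul, mul_one, Finset.card_univ] at h1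
  linarith

/-- The law of the embedded graph is almost stochastically dominated by `𝒢(n, d)`. -/
theorem sum_inhomogeneousWeight_le (h : IsModerate d Δ γ) {δ : ℝ} (hδ : ∀ v, δ ≤ d v)
    (herr : 2 * n * Real.exp (-((γ ^ 2 / 10) ^ 2 / 4 * δ)) * (n : ℝ) ^ 2 ≤ γ)
    {U : Finset (SimpleGraph (Fin n))} (hU : IsUpperSet (U : Set (SimpleGraph (Fin n)))) :
    ∑ G ∈ U, inhomogeneousWeight (embeddingMatrix d γ) G ≤ ∑ G ∈ U, degreeWeight d G + γ := by
  classical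
  have hγ := h.pos
  have hγ2 := h.le_half
  set φ : SimpleGraph (Fin n) → ℝ := fun G => if G ∈ U then 1 else 0 with hφ
  -- The test function is the indicator of `U`, monotone because `U` is an upper set. Stopping at 1
  -- - γ keeps the residual degrees of typical thinnings large.
  have hmain := sum_productWeight_mul_le (𝒞 := degreeFamily d) (card_eq d)
    (θ := edgeRate d γ) h.edgeRate_nonneg (τ := 1 - γ) (by linarith) (by linarith)
    (HasFraction d (γ ^ 2 / 10)) (fun t ht0 ht1 H hH e he => by
      induction e using Sym2.inductionOn with
      | hf j k =>
        by_cases hjk : j = k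
        · simp [edgeRate, hjk]
        · simp only [edgeRate, Sym2.lift_mk, if_neg hjk]
          exact h.mul_extCount_le_extCount_insert ht0 ht1 hH hjk he)
    (β := 2 * n * Real.exp (-((γ ^ 2 / 10) ^ 2 / 4 * δ))) (fun t ht0 ht1 G hG => by
      have := sum_productWeight_not_hasFraction_le hG ht0 (by linarith) (κ := γ ^ 2 / 10)
        (by positivity) (by nlinarith) hδ
      rwa [Fintype.card_fin] at this)
    (f := fun R => φ (SimpleGraph.fromEdgeSet (R : Set (Sym2 (Fin n)))))
    (fun R S hRS => by
      have hle : SimpleGraph.fromEdgeSet (R : Set (Sym2 (Fin n))) ≤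
          SimpleGraph.fromEdgeSet (S : Set (Sym2 (Fin n))) :=
        SimpleGraph.fromEdgeSet_mono (by exact_mod_cast hRS)
      simp only [hφ]
      split_ifs with h1 h2 h2
      · exact le_rfl
      · exact absurd (hU hle h1) h2
      · exact zero_le_one
      · exact le_rfl)
    (fun S => by simp only [hφ]; split_ifs <;> norm_num)
    (fun S => by simp only [hφ]; split_ifs <;> norm_num)
  have hpos : 0 < ((degreeFamily d).card : ℝ) := by
    exact_mod_cast Finset.card_pos.2 h.nonempty
  have h1 := sum_productWeight_mul_fromEdgeSet (W := embeddingMatrix d γ)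
    (w := embeddingProb d γ) (fun j k => rfl)
    (fun j => by simp [embeddingMatrix, embeddingProb, edgeRate]) φ
  have h2 := sum_degreeWeight_mul d φ
  have h3 : ∀ w : SimpleGraph (Fin n) → ℝ, ∑ G, w G * φ G = ∑ G ∈ U, w G := by
    intro w
    simp [hφ]
  change _ * ∑ R : Finset (Sym2 (Fin n)), productWeight (embeddingProb d γ) R *
    φ (SimpleGraph.fromEdgeSet (R : Set _)) ≤ _ at hmain
  rw [h1, h3] at hmain
  rw [h3] at h2
  rw [h2]
  have h4 : (1 - γ) * (2 * n * Real.exp (-((γ ^ 2 / 10) ^ 2 / 4 * δ)) * ∑ e, edgeRate d γ e) ≤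
      γ := by
    have h5 : 2 * n * Real.exp (-((γ ^ 2 / 10) ^ 2 / 4 * δ)) * ∑ e, edgeRate d γ e ≤ γ :=
      (mul_le_mul_of_nonneg_left h.sum_edgeRate_le (by positivity)).trans herr
    have h6 : 0 ≤ 2 * n * Real.exp (-((γ ^ 2 / 10) ^ 2 / 4 * δ)) * ∑ e, edgeRate d γ e :=
      mul_nonneg (by positivity) (Finset.sum_nonneg fun e _ => h.edgeRate_nonneg e)
    nlinarith
  refine le_of_mul_le_mul_left (a := ((degreeFamily d).card : ℝ)) (hmain.trans ?_) hpos
  rw [mul_add, mul_inv_cancel_left₀ hpos.ne']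
  have := mul_le_mul_of_nonneg_left h4 hpos.le
  linarith

theorem exists_coupling (h : IsModerate d Δ γ) {δ : ℝ} (hδ : ∀ v, δ ≤ d v)
    (herr : 2 * n * Real.exp (-((γ ^ 2 / 10) ^ 2 / 4 * δ)) * (n : ℝ) ^ 2 ≤ γ) :
    ∃ μ : Measure (SimpleGraph (Fin n) × SimpleGraph (Fin n)),
      IsCoupling μ (inhomogeneousGraph (embeddingMatrix d γ)) (degreeGraph d) ∧
      ENNReal.ofReal (1 - γ) ≤ μ {p | p.1 ≤ p.2} := by
  classical
  have hweight : ∀ G, inhomogeneousWeight (embeddingMatrix d γ) G =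
      productWeight (embeddingProb d γ) G.edgeFinset :=
    inhomogeneousWeight_eq_productWeight (fun j k => rfl)
      (fun j => by simp [embeddingMatrix, embeddingProb, edgeRate])
  have hone : ∑ G, inhomogeneousWeight (embeddingMatrix d γ) G = 1 := by
    have := sum_productWeight_mul_fromEdgeSet (W := embeddingMatrix d γ)
      (w := embeddingProb d γ) (fun j k => rfl)
      (fun j => by simp [embeddingMatrix, embeddingProb, edgeRate]) fun _ => 1
    simpa [sum_productWeight] using this.symm
  obtain ⟨J, hJ, hμ, hν, hdom⟩ := exists_coupling_of_upperSet_le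
    (μ := inhomogeneousWeight (embeddingMatrix d γ)) (ν := degreeWeight d)
    (fun G => by
      rw [hweight]
      exact productWeight_nonneg h.embeddingProb_nonneg (embeddingProb_le_one d γ) _)
    (degreeWeight_nonneg d) hone (sum_degreeWeight h.nonempty)
    (fun U hU => h.sum_inhomogeneousWeight_le hδ herr hU)
  refine ⟨Measure.sum fun p => ENNReal.ofReal (J p.1 p.2) • Measure.dirac p, ?_, ?_⟩
  · rw [degreeGraph_eq_sum h.nonempty]
    exact isCoupling_of_marginals hJ hμ hν hone
  · rw [sum_ofReal_smul_dirac_apply fun p : SimpleGraph (Fin n) × SimpleGraph (Fin n) =>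
      hJ p.1 p.2]
    exact ENNReal.ofReal_le_ofReal (hdom _ fun x y hxy => by simpa using hxy)

/-- The edge probabilities of `𝒢(n, d)`. -/
theorem abs_degreeGraph_adj_sub_le (h : IsModerate d Δ γ) {j k : Fin n} (hjk : j ≠ k) :
    |(degreeGraph d).real {G | G.Adj j k} - edgeMatrix d j k| ≤ 4 * γ * edgeMatrix d j k := by
  have hpos : 0 < ((degreeFamily d).card : ℝ) := by
    exact_mod_cast Finset.card_pos.2 h.nonempty
  obtain ⟨hlow, hup⟩ := h.extCount_singleton_bounds hjk
  change (1 - γ) * ((d j * d k : ℝ) / total d) * _ ≤ _ at hlow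
  change _ ≤ (d j * d k : ℝ) / total d * _ at hup
  have hxγ := h.div_total_le j k
  have hγ := h.pos
  have hγ2 := h.le_half
  rw [degreeGraph_real_adj h.nonempty hjk, h.edgeMatrix_eq hjk]
  set x : ℝ := (d j * d k : ℝ) / total d
  have hx0 : 0 ≤ x := by positivity
  rw [← le_div_iff₀ hpos] at hlow
  rw [← div_le_iff₀ hpos, mul_div_assoc] at hup
  set p : ℝ := (extCount (degreeFamily d) {s(j, k)} : ℝ) / (degreeFamily d).card
  set P : ℝ := x / (1 + x) with hPdef
  have hP0 : 0 ≤ P := by positivity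
  have hPx : x = P * (1 + x) := (div_mul_cancel₀ x (by positivity)).symm
  have h1 : P ≤ x := div_le_self hx0 (by linarith)
  -- Switching gives (1 - γ) x ≤ p and (1 - γ) p ≤ x, while `x` and `P` differ by the factor 1 + x ≤
  -- 1 + γ. The constant 4 comes from (1 + γ) / (1 - γ) ≤ 1 + 4γ, valid for γ ≤ 1/2.
  have h2 : x ≤ P * (1 + γ) := by
    nlinarith
  rw [abs_le]
  constructor
  · have : (1 - γ) * P ≤ (1 - γ) * x := mul_le_mul_of_nonneg_left h1 (by linarith)
    nlinarith [mul_nonneg hγ.le hP0]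
  · have h3 : (1 + γ) * P ≤ (1 - γ) * ((1 + 4 * γ) * P) := by
      have : (1 + γ) ≤ (1 - γ) * (1 + 4 * γ) := by nlinarith
      have := mul_le_mul_of_nonneg_right this hP0
      linarith
    have h4 : p ≤ (1 + 4 * γ) * P := by
      refine le_of_mul_le_mul_left (a := 1 - γ) ?_ (by linarith)
      linarith
    linarith

end IsModerate

end Embedding

/-! ### Letting the precision tend to zero. -/

section Asymptotics

/-- If a monotone property holds eventually for every fixed positive parameter, it holds eventually
for a parameter that tends to zero. -/
theorem exists_tendsto_zero_of_forall_eventually {Q : ℝ → ℕ → Prop}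
    (hmono : ∀ n a b, a ≤ b → Q a n → Q b n) (h : ∀ γ > 0, ∀ᶠ n in atTop, Q γ n) :
    ∃ ε : ℕ → ℝ, Tendsto ε atTop (𝓝 0) ∧ ∀ᶠ n in atTop, Q (ε n) n := by
  have hbdd : ∀ n, BddBelow {γ : ℝ | 0 < γ ∧ Q γ n} := fun n => ⟨0, fun γ hγ => hγ.1.le⟩
  have hinf : ∀ n, 0 ≤ sInf {γ : ℝ | 0 < γ ∧ Q γ n} := fun n =>
    Real.sInf_nonneg fun γ hγ => hγ.1.le
  -- The infimum of the admissible parameters tends to 0 but need not be admissible; adding 1 / (n +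
  -- 1) moves strictly above it, where monotonicity applies.
  refine ⟨fun n => sInf {γ : ℝ | 0 < γ ∧ Q γ n} + 1 / ((n : ℝ) + 1), ?_, ?_⟩
  · have h1 : Tendsto (fun n => sInf {γ : ℝ | 0 < γ ∧ Q γ n}) atTop (𝓝 0) := by
      rw [Metric.tendsto_atTop']
      intro γ hγ
      obtain ⟨N, hN⟩ := eventually_atTop.1 (h (γ / 2) (half_pos hγ))
      refine ⟨N, fun n hn => ?_⟩
      rw [Real.dist_0_eq_abs, abs_of_nonneg (hinf n)]
      exact (csInf_le (hbdd n) ⟨half_pos hγ, hN n hn.le⟩).trans_lt (half_lt_self hγ)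
    simpa using h1.add tendsto_one_div_add_atTop_nhds_zero_nat
  · filter_upwards [h 1 one_pos] with n hn
    obtain ⟨γ, hγ, hlt⟩ := exists_lt_of_csInf_lt (s := {γ : ℝ | 0 < γ ∧ Q γ n})
      ⟨1, one_pos, hn⟩ (lt_add_of_pos_right (sInf {γ : ℝ | 0 < γ ∧ Q γ n})
        (by positivity : (0 : ℝ) < 1 / ((n : ℝ) + 1)))
    exact hmono n γ _ hlt.le hγ.2

variable {d : (n : ℕ) → Fin n → ℕ}

theorem minDeg_le {n : ℕ} (d : Fin n → ℕ) (v : Fin n) : minDeg d ≤ d v :=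
  ciInf_le (OrderBot.bddBelow _) v

theorem eventually_isModerate (heven : ∀ n, Even (total (d n)))
    (hmax : (fun n => (maxDeg (d n) : ℝ) ^ 2) =o[atTop] fun n => (total (d n) : ℝ))
    (hmin : (fun n : ℕ => Real.log n) =o[atTop] fun n => (minDeg (d n) : ℝ))
    {γ : ℝ} (hγ : 0 < γ) (hγ2 : γ ≤ 1 / 2) :
    ∀ᶠ n in atTop, IsModerate (d n) (maxDeg (d n)) γ ∧
      2 * n * Real.exp (-((γ ^ 2 / 10) ^ 2 / 4 * (minDeg (d n) : ℝ))) * (n : ℝ) ^ 2 ≤ γ := by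
  set K : ℝ := (γ ^ 2 / 10) ^ 2 / 4 with hK
  have hK0 : 0 < K := by positivity
  have hlog : Tendsto (fun n : ℕ => Real.log n) atTop atTop :=
    Real.tendsto_log_atTop.comp tendsto_natCast_atTop_atTop
  -- The constant γ³/200 yields `sq_le`. The constant K/4 makes exp(-Kδ) at most n⁻⁴, so that the
  -- error is at most 2n · n⁻⁴ · n² = 2/n. The bounds log n ≤ δ and log n ≥ 20/γ² make all degrees
  -- large.
  filter_upwards [hmax.bound (by positivity : 0 < γ ^ 3 / 200),
    hmin.bound (by positivity : 0 < K / 4), hmin.bound one_pos,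
    hlog.eventually_ge_atTop (20 / γ ^ 2), eventually_gt_atTop 0,
    tendsto_natCast_atTop_atTop.eventually_ge_atTop (2 / γ)] with n h1 h2 h3 h4 h5 h6
  rw [Real.norm_of_nonneg (by positivity), Real.norm_of_nonneg (by positivity)] at h1
  rw [Real.norm_of_nonneg (Nat.cast_nonneg _)] at h2 h3
  have h7 : Real.log n ≤ minDeg (d n) := (le_abs_self _).trans (h3.trans_eq (one_mul _))
  have h8 : ∀ v, 20 ≤ γ ^ 2 * (d n v : ℝ) := by
    intro v
    have : (minDeg (d n) : ℝ) ≤ d n v := by exact_mod_cast minDeg_le (d n) v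
    have h9 : 20 / γ ^ 2 ≤ d n v := by linarith
    rw [div_le_iff₀ (by positivity)] at h9
    linarith
  have hdeg : ∀ v, d n v ≤ maxDeg (d n) := fun v => Finset.le_sup (f := d n) (Finset.mem_univ v)
  refine ⟨⟨hγ, hγ2, ?_, hdeg, h8, ?_, heven n⟩, ?_⟩
  · refine le_trans ?_ (hdeg ⟨0, h5⟩)
    by_contra! h0
    have := h8 ⟨0, h5⟩
    rw [Nat.lt_one_iff.1 h0] at this
    norm_num at this
  · change _ ≤ γ ^ 3 * (total (d n) : ℝ)
    linarith
  · have hn : (0 : ℝ) < n := by exact_mod_cast h5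
    have h9 : Real.log n ≤ K / 4 * minDeg (d n) := (le_abs_self _).trans h2
    have h10 : Real.exp (-(K * (minDeg (d n) : ℝ))) ≤ ((n : ℝ) ^ 4)⁻¹ := by
      rw [← Real.exp_log (pow_pos hn 4), ← Real.exp_neg, Real.exp_le_exp, Real.log_pow]
      push_cast
      linarith
    calc _ ≤ 2 * n * ((n : ℝ) ^ 4)⁻¹ * (n : ℝ) ^ 2 := by gcongr
      _ = 2 / n := by field_simp
      _ ≤ γ := by
        rw [div_le_iff₀ hγ] at h6
        rw [div_le_iff₀ hn]
        linarith

theorem edgeMatrix_nonneg {n : ℕ} (d : Fin n → ℕ) (j k : Fin n) : 0 ≤ edgeMatrix d j k := by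
  simp only [edgeMatrix, Matrix.of_apply]
  split_ifs
  · exact le_rfl
  · positivity

/-- `W` is within a factor `1 - γ` below `P(d)`, and `μ` couples `𝒢(n, W)` and `𝒢(n, d)` so that
the first graph is contained in the second with probability at least `1 - γ`. -/
def IsEmbedding {n : ℕ} (d : Fin n → ℕ) (γ : ℝ) (W : Matrix (Fin n) (Fin n) ℝ)
    (μ : Measure (SimpleGraph (Fin n) × SimpleGraph (Fin n))) : Prop :=
  (W.IsSymm ∧ (∀ j k, 0 ≤ W j k ∧ W j k ≤ 1) ∧
    (∀ j k, (1 - γ) * edgeMatrix d j k ≤ W j k ∧ W j k ≤ edgeMatrix d j k) ∧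
    IsCoupling μ (inhomogeneousGraph W) (degreeGraph d)) ∧
  ENNReal.ofReal (1 - γ) ≤ μ {p | p.1 ≤ p.2}

theorem exists_embedding (heven : ∀ n, Even (total (d n)))
    (hmax : (fun n => (maxDeg (d n) : ℝ) ^ 2) =o[atTop] fun n => (total (d n) : ℝ))
    (hmin : (fun n : ℕ => Real.log n) =o[atTop] fun n => (minDeg (d n) : ℝ)) :
    ∃ (W : (n : ℕ) → Matrix (Fin n) (Fin n) ℝ) (ε : ℕ → ℝ)
        (μ : (n : ℕ) → Measure (SimpleGraph (Fin n) × SimpleGraph (Fin n))),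
      Tendsto ε atTop (𝓝 0) ∧
      (∀ᶠ n in atTop,
        (W n).IsSymm ∧
        (∀ j k, 0 ≤ W n j k ∧ W n j k ≤ 1) ∧
        (∀ j k, (1 - ε n) * edgeMatrix (d n) j k ≤ W n j k ∧ W n j k ≤ edgeMatrix (d n) j k) ∧
        IsCoupling (μ n) (inhomogeneousGraph (W n)) (degreeGraph (d n))) ∧
      Tendsto (fun n => μ n {p | p.1 ≤ p.2}) atTop (𝓝 1) := by
  obtain ⟨ε, hε, hQ⟩ := exists_tendsto_zero_of_forall_eventually
    (Q := fun γ n => ∃ W μ, IsEmbedding (d n) γ W μ)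
    (by
      rintro n a b hab ⟨W, μ, ⟨h1, h2, h3, h4⟩, h5⟩
      refine ⟨W, μ, ⟨h1, h2, fun j k => ⟨le_trans ?_ (h3 j k).1, (h3 j k).2⟩, h4⟩,
        (ENNReal.ofReal_le_ofReal (by linarith)).trans h5⟩
      exact mul_le_mul_of_nonneg_right (by linarith) (edgeMatrix_nonneg _ _ _))
    (by
      intro γ hγ
      -- The third compensates for the factor 1 - 3γ in the matrix bound; the cap 1/2 is required by
      -- `IsModerate`.
      have hγ' : 0 < min (γ / 3) (1 / 2) := lt_min (by positivity) (by norm_num)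
      have hle := min_le_left (γ / 3) (1 / 2)
      filter_upwards [eventually_isModerate heven hmax hmin hγ' (min_le_right _ _)] with n hn
      obtain ⟨hmod, herr⟩ := hn
      obtain ⟨μ, hμ, hμS⟩ := hmod.exists_coupling
        (fun v => Nat.cast_le.2 (minDeg_le (d n) v)) herr
      refine ⟨embeddingMatrix (d n) (min (γ / 3) (1 / 2)), μ, ⟨?_, fun j k => ⟨?_, ?_⟩,
        fun j k => ⟨?_, (hmod.embeddingMatrix_bounds j k).2⟩, hμ⟩, ?_⟩
      · ext j k
        simp only [Matrix.transpose_apply, embeddingMatrix, Matrix.of_apply, Sym2.eq_swap]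
      · exact hmod.embeddingProb_nonneg _
      · exact IsModerate.embeddingProb_le_one _ _ _
      · refine le_trans ?_ (hmod.embeddingMatrix_bounds j k).1
        exact mul_le_mul_of_nonneg_right (by linarith) (edgeMatrix_nonneg _ _ _)
      · exact (ENNReal.ofReal_le_ofReal (by linarith)).trans hμS)
  -- Where no embedding exists, which happens for finitely many n only, the chosen values are
  -- irrelevant.
  have hchoice : ∀ n, ∃ W μ, (∃ W μ, IsEmbedding (d n) (ε n) W μ) →
      IsEmbedding (d n) (ε n) W μ := by
    intro n
    by_cases h : ∃ W μ, IsEmbedding (d n) (ε n) W μ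
    · obtain ⟨W, μ, hWμ⟩ := h
      exact ⟨W, μ, fun _ => hWμ⟩
    · exact ⟨0, 0, fun h' => absurd h' h⟩
  choose W μ hWμ using hchoice
  refine ⟨W, ε, μ, hε, ?_, ?_⟩
  · filter_upwards [hQ] with n hn
    exact (hWμ n hn).1
  · have hlim : Tendsto (fun n => ENNReal.ofReal (1 - ε n)) atTop (𝓝 1) := by
      have := ENNReal.tendsto_ofReal (hε.const_sub 1)
      simpa using this
    refine tendsto_of_tendsto_of_tendsto_of_le_of_le' hlim tendsto_const_nhds ?_ ?_
    · filter_upwards [hQ] with n hn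
      exact (hWμ n hn).2
    · filter_upwards [hQ] with n hn
      have := (hWμ n hn).1.2.2.2.isProbabilityMeasure
      exact prob_le_one

theorem exists_edgeMatrix_asymptotic (heven : ∀ n, Even (total (d n)))
    (hmax : (fun n => (maxDeg (d n) : ℝ) ^ 2) =o[atTop] fun n => (total (d n) : ℝ))
    (hmin : (fun n : ℕ => Real.log n) =o[atTop] fun n => (minDeg (d n) : ℝ)) :
    ∃ η : ℕ → ℝ, Tendsto η atTop (𝓝 0) ∧
      ∀ᶠ n in atTop, ∀ j k, j ≠ k →
        |(degreeGraph (d n)).real {G | G.Adj j k} - edgeMatrix (d n) j k| ≤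
          η n * edgeMatrix (d n) j k := by
  refine exists_tendsto_zero_of_forall_eventually (Q := fun γ n => ∀ j k, j ≠ k →
    |(degreeGraph (d n)).real {G | G.Adj j k} - edgeMatrix (d n) j k| ≤
      γ * edgeMatrix (d n) j k) ?_ ?_
  · intro n a b hab h j k hjk
    exact (h j k hjk).trans (mul_le_mul_of_nonneg_right hab (edgeMatrix_nonneg _ _ _))
  · intro γ hγ
    have hγ' : 0 < min (γ / 4) (1 / 2) := lt_min (by positivity) (by norm_num)
    have hle := min_le_left (γ / 4) (1 / 2)
    filter_upwards [eventually_isModerate heven hmax hmin hγ' (min_le_right _ _)] with n hn j k hjk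
    exact (hn.1.abs_degreeGraph_adj_sub_le hjk).trans
      (mul_le_mul_of_nonneg_right (by linarith) (edgeMatrix_nonneg _ _ _))

end Asymptotics

end RandomGraphEmbedding

theorem mainTheorem2
    (d : (n : ℕ) → Fin n → ℕ)
    (heven : ∀ n, Even (RandomGraphEmbedding.total (d n)))
    (hmax : (fun n => (RandomGraphEmbedding.maxDeg (d n) : ℝ) ^ 2)
      =o[atTop] fun n => (RandomGraphEmbedding.total (d n) : ℝ))
    (hmin : (fun n : ℕ => Real.log n)
      =o[atTop] fun n => (RandomGraphEmbedding.minDeg (d n) : ℝ)) :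
    -- the embedding of `𝒢(n, W)` into `𝒢(n, d)`
    (∃ (W : (n : ℕ) → Matrix (Fin n) (Fin n) ℝ) (ε : ℕ → ℝ)
        (μ : (n : ℕ) → Measure (SimpleGraph (Fin n) × SimpleGraph (Fin n))),
      Tendsto ε atTop (𝓝 0) ∧
      (∀ᶠ n in atTop,
        (W n).IsSymm ∧
        (∀ j k, 0 ≤ W n j k ∧ W n j k ≤ 1) ∧
        (∀ j k, (1 - ε n) * RandomGraphEmbedding.edgeMatrix (d n) j k ≤ W n j k ∧
          W n j k ≤ RandomGraphEmbedding.edgeMatrix (d n) j k) ∧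
        RandomGraphEmbedding.IsCoupling (μ n)
          (RandomGraphEmbedding.inhomogeneousGraph (W n))
          (RandomGraphEmbedding.degreeGraph (d n))) ∧
      Tendsto (fun n => μ n {p | p.1 ≤ p.2}) atTop (𝓝 1)) ∧
    -- its optimality: `P(d)` is uniformly asymptotic to the true edge probabilities
    (∃ η : ℕ → ℝ, Tendsto η atTop (𝓝 0) ∧
      ∀ᶠ n in atTop, ∀ j k, j ≠ k →
        |(RandomGraphEmbedding.degreeGraph (d n)).real {G | G.Adj j k} -
            RandomGraphEmbedding.edgeMatrix (d n) j k|
          ≤ η n * RandomGraphEmbedding.edgeMatrix (d n) j k) :=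
  ⟨RandomGraphEmbedding.exists_embedding heven hmax hmin,
    RandomGraphEmbedding.exists_edgeMatrix_asymptotic heven hmax hmin⟩
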